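/- Let $k$ be a field, let $S=k[x_0,x_1,x_2,x_3]$ be the standard graded polynomial ring, let $d\ge 0$ be an integer, and let $J\subset S$ be a homogeneous ideal of codimension $2$ having a minimal graded free resolution $$0\to S(-(d+2))\xrightarrow{\ \psi\ } S(-(d+1))^3\oplus S(-(2d-1))\xrightarrow{\ \phi\ } S(-d)^4\xrightarrow{\ f\ } J\to 0$$ (necessarily $d\ge 2$), where $f=(f_0,f_1,f_2,f_3)$ are the corresponding generators of $J$. The unmixed part $J^{\rm un}$ of $J$ is the intersection of the primary components of $J$ of minimal codimension, and $J$ is unmixed if $J^{\rm un}=J$. If $d=2$, assume moreover that $J$ is not unmixed. Then: (i) $S/J$ has exactly one associated prime of codimension $3$, and this prime is the ideal generated by the entries of $\psi$. (ii) Up to a linear change of variables and elementary row operations (over $k$), one has $$\psi=\begin{pmatrix}x_0\\x_1\\x_2\\0\end{pmatrix},\qquad \phi=\left(\begin{array}{ccc|c}&&&-q_0\\&\mathcal K&&-q_1\\&&&-q_2\\\hline 0&0&0&q\end{array}\right),\qquad \mathcal K=\begin{pmatrix}0&x_2&-x_1\\-x_2&0&x_0\\x_1&-x_0&0\end{pmatrix},$$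 $$J=(qx_0,\;qx_1,\;qx_2,\;q_0x_0+q_1x_1+q_2x_2)$$ for suitable forms $q_0,q_1,q_2,q\in S$ of degree $d-1$ (the $q_i$ may be zero); here $\mathcal K$ is the Koszul syzygy matrix of $x_0,x_1,x_2$. Precisely: there are a $k$-algebra automorphism $\tau$ of $S$ taking variables to linear forms and matrices $A,B\in GL_4(k)$, with $B=1$ if $d\ge 3$, such that $B\,\tau(\psi)$ and $A\,\tau(\phi)\,B^{-1}$ are the two matrices displayed above, $\tau(f)A^{-1}=(qx_0,qx_1,qx_2,q_0x_0+q_1x_1+q_2x_2)$, and $\tau(J)$ is the ideal displayed above. Moreover, in these coordinates (that is, for $\tau(J^{\rm un})$), $$J^{\rm un}=(q,\;q_0x_0+q_1x_1+q_2x_2),$$ where $q,\;q_0x_0+q_1x_1+q_2x_2$ is a regular sequence, so that $J^{\rm un}$ is a complete intersection; its degree (the multiplicity of $S/J^{\rm un}$, read off from its Hilbert polynomial) is $(d-1)d$. -/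

import Mathlib

open MvPolynomial

/-- The matrix `M` over the polynomial ring `S` represents a homomorphism of graded modules
(homogeneous of degree `0`) `⨁ j, S(-a j) ⟶ ⨁ i, S(-b i)`: the entry `M i j` is zero or a form of
degree `a j - b i`. -/
def IsGradedMatrix {k σ ι κ : Type*} [CommSemiring k] (b : ι → ℤ) (a : κ → ℤ)
    (M : Matrix ι κ (MvPolynomial σ k)) : Prop :=
  ∀ i j, ∀ m ∈ (M i j).support, (m.degree : ℤ) = a j - b i

/-- The sequence
`0 ⟶ ⨁ S(-a₂ j) --ψ--> ⨁ S(-a₁ j) --φ--> ⨁ S(-a₀ j) --f--> J ⟶ 0`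
is a minimal graded free resolution of the ideal `J` of the standard graded polynomial ring
`S = k[x_i : i ∈ σ]`. Here the map `f` sends the `j`-th basis vector to the generator `f j`,
and minimality means that the matrices `φ` and `ψ` have all their entries in the maximal ideal
generated by the variables. -/
structure IsMinimalGradedResolution {k σ ι₀ ι₁ ι₂ : Type*} [Field k]
    [Fintype ι₀] [Fintype ι₁] [Fintype ι₂]
    (J : Ideal (MvPolynomial σ k)) (a₀ : ι₀ → ℤ) (a₁ : ι₁ → ℤ) (a₂ : ι₂ → ℤ)
    (f : ι₀ → MvPolynomial σ k) (φ : Matrix ι₀ ι₁ (MvPolynomial σ k))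
    (ψ : Matrix ι₁ ι₂ (MvPolynomial σ k)) : Prop where
  graded_f : ∀ j, ∀ m ∈ (f j).support, (m.degree : ℤ) = a₀ j
  graded_φ : IsGradedMatrix a₀ a₁ φ
  graded_ψ : IsGradedMatrix a₁ a₂ ψ
  span_f : Ideal.span (Set.range f) = J
  exact_φ_f : Function.Exact φ.mulVecLin (Fintype.linearCombination (MvPolynomial σ k) f)
  exact_ψ_φ : Function.Exact ψ.mulVecLin φ.mulVecLin
  injective_ψ : Function.Injective ψ.mulVecLin
  minimal_φ : ∀ i j, φ i j ∈ Ideal.span (Set.range (X : σ → MvPolynomial σ k))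
  minimal_ψ : ∀ i j, ψ i j ∈ Ideal.span (Set.range (X : σ → MvPolynomial σ k))

/-- `Q` is a primary component of `I`: a member of some irredundant primary decomposition of `I`. -/
def IsPrimaryComponent {R : Type*} [CommRing R] (I Q : Ideal R) : Prop :=
  ∃ t : Finset (Ideal R), Submodule.IsMinimalPrimaryDecomposition I t ∧ Q ∈ t

/-- The unmixed part of `I`: the intersection of the primary components of `I` of minimal
codimension, that is, of the same codimension as `I`. (These components belong to minimal primes,
hence do not depend on the decomposition.) -/
def unmixedPart {R : Type*} [CommRing R] (I : Ideal R) : Ideal R :=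
  sInf {Q | IsPrimaryComponent I Q ∧ Q.height = I.height}

/-- `I` is unmixed if it is equal to its unmixed part. -/
def IsUnmixed {R : Type*} [CommRing R] (I : Ideal R) : Prop :=
  unmixedPart I = I

/-- The Hilbert function `t ↦ dim_k (S/I)_t` of a homogeneous ideal `I` of `S`; here `(S/I)_t` is
the image of the space of forms of degree `t`. -/
noncomputable def hilbertFn {k σ : Type*} [Field k] (I : Ideal (MvPolynomial σ k)) (t : ℕ) : ℕ :=
  Module.finrank k
    ((homogeneousSubmodule σ k t).map (Ideal.Quotient.mkₐ k I).toLinearMap)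

/-- The homogeneous ideal `I` has degree (multiplicity) `e`: if `P` is the Hilbert polynomial of
`S/I`, then `e = (deg P)! * (leading coefficient of P)`. -/
def HasDegree {k σ : Type*} [Field k] (I : Ideal (MvPolynomial σ k)) (e : ℕ) : Prop :=
  ∃ P : Polynomial ℚ, (∀ᶠ t : ℕ in Filter.atTop, (hilbertFn I t : ℚ) = P.eval (t : ℚ)) ∧
    (e : ℚ) = (P.natDegree.factorial : ℚ) * P.leadingCoeff

/-- A linear change of variables: a `k`-algebra automorphism of the polynomial ring taking every
variable to a linear form. -/
def IsLinearChange {k σ : Type*} [Field k] (τ : MvPolynomial σ k ≃ₐ[k] MvPolynomial σ k) : Prop :=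
  ∀ i, (τ (X i)).IsHomogeneous 1

/-- The matrix with block form `(𝒦 | -q₀, -q₁, -q₂)` over `(0 0 0 | q)`, where `𝒦` is the Koszul
syzygy matrix of `x₀, x₁, x₂`, with the basis of `⋀² S³` in the order and with the signs for which
`𝒦 (x₀, x₁, x₂)ᵀ = 0`. -/
noncomputable def koszulNormalForm {k : Type*} [Field k] (q₀ q₁ q₂ q : MvPolynomial (Fin 4) k) :
    Matrix (Fin 4) (Fin 4) (MvPolynomial (Fin 4) k) :=
  !![0, X 2, -X 1, -q₀;
     -X 2, 0, X 0, -q₁;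
     X 1, -X 0, 0, -q₂;
     0, 0, 0, q]

/-- An invertible matrix of scalars, seen as a matrix over the polynomial ring. -/
noncomputable def scalarMatrix {k : Type*} [Field k] (A : Matrix.GeneralLinearGroup (Fin 4) k) :
    Matrix (Fin 4) (Fin 4) (MvPolynomial (Fin 4) k) :=
  (A : Matrix (Fin 4) (Fin 4) k).map C

/-!
*The last entry of `ψ`.* It has degree `3 - d` and no constant term. So it vanishes for `d ≥ 3`, and
for `d = 2` a change of basis makes it vanish as soon as the four linear entries of `ψ` are
dependent. If they are independent, then `J` is unmixed (`IsFourGeneratorResolution.isUnmixed`): if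
it is not, some associated prime has height at least three, and a regular sequence of length three
in such a prime `P` allows one to climb the resolution (`exists_eq_of_regularTriple_mul_mem`), which
gives first that `P` contains the four entries of `ψ`, and then that `J : P = J`, contrary to the
choice of `P`.

*The normal form.* With last entry zero, the other entries `l₀, l₁, l₂` of `ψ` are linear forms,
independent by minimality (`IsFourGeneratorResolution.linearIndependent_ψ`), and become variables
after a linear change of coordinates. By `φ ψ = 0` the linear columns of `φ` consist of Koszul
syzygies, and row operations turn them into the Koszul matrix. Then `f φ = 0` forces `f = (g l₀, g
l₁, g l₂, g₃)`, and the last column `(-q₀, -q₁, -q₂, q)` gives `g h = g₃ q` with `h = q₀ l₀ + q₁ l₁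
+ q₂ l₂`. Codimension two means that `g` and `g₃` are coprime, and comparing degrees one may take `g
= q`, `g₃ = h` (`IsFourGeneratorResolution.exists_normalForm`).

*The primary decomposition.* Now `J = (q l₀, q l₁, q l₂, h)` with `q, h` a regular sequence, and
`(l₀, l₁, l₂) (q, h) ⊆ J ⊆ (q, h)`. The complete intersection `(q, h)` has no associated primes of
height three or more (`PrimesHaveGradeThree.height_le_two`), and `J` agrees with it locally away
from `(l₀, l₁, l₂)`, so that `(q, h)` is the unmixed part of `J` (`unmixedPart_eq_span_pair`). As `J
: q = (l₀, l₁, l₂)`, this prime is associated, and it is the only one of height three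
(`associatedPrimes_height_three_eq`). The degree of `(q, h)` comes from the Koszul complex
(`hasDegree_span_pair`).

In place of the Cohen–Macaulay property of `S`, the proof uses only that every prime of height at
least three contains a regular sequence of length three, in the elementwise form of
`PrimesHaveGradeThree`. This is proved by adjoining one variable at a time, with McCoy's theorem and
prime avoidance (`PrimesHaveGradeThree.polynomial`).
-/

/-! ### Regular sequences of length three and a depth argument -/

/-- `a, b, c` is a weakly regular sequence on `M`, spelled out on elements: each of `a`, `b`, `c`
is a nonzerodivisor modulo the multiples of its predecessors. Properness `(a, b, c) M ≠ M` is not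
required. -/
structure IsRegularTriple {R : Type*} [CommRing R] (M : Type*) [AddCommGroup M] [Module R M]
    (a b c : R) : Prop where
  fst : ∀ x : M, a • x = 0 → x = 0
  snd : ∀ x y : M, b • x = a • y → ∃ z, x = a • z
  thd : ∀ x y z : M, c • x = a • y + b • z → ∃ u v, x = a • u + b • v

namespace IsRegularTriple

variable {R : Type*} [CommRing R] {a b c : R}

lemma pi {M : Type*} [AddCommGroup M] [Module R M] (h : IsRegularTriple M a b c) (ι : Type*) :
    IsRegularTriple (ι → M) a b c where
  fst x hx := funext fun i => h.fst _ (congrFun hx i)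
  snd x y hxy := by
    choose z hz using fun i => h.snd (x i) (y i) (congrFun hxy i)
    exact ⟨z, funext hz⟩
  thd x y z hxyz := by
    choose u v huv using fun i => h.thd (x i) (y i) (z i) (congrFun hxyz i)
    exact ⟨u, v, funext huv⟩

lemma map {R' : Type*} [CommRing R'] (e : R ≃+* R') (h : IsRegularTriple R a b c) :
    IsRegularTriple R' (e a) (e b) (e c) where
  fst x hx := by
    have := h.fst (e.symm x) (e.injective (by simpa using hx))
    simpa using this
  snd x y hxy := by
    obtain ⟨z, hz⟩ := h.snd (e.symm x) (e.symm y) (e.injective (by simpa using hxy))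
    exact ⟨e z, by simpa using congrArg e hz⟩
  thd x y z hxyz := by
    obtain ⟨u, v, huv⟩ := h.thd (e.symm x) (e.symm y) (e.symm z)
      (e.injective (by simpa using hxyz))
    exact ⟨e u, e v, by simpa using congrArg e huv⟩

/-- Exactness of the Koszul complex of a regular sequence of length three at `⋀²`. -/
lemma exists_koszul {M : Type*} [AddCommGroup M] [Module R M] (h : IsRegularTriple M a b c)
    {x y z : M} (hxyz : c • x - b • y + a • z = 0) :
    ∃ u v w : M, x = b • u - a • v ∧ y = c • u - a • w ∧ z = c • v - b • w := by
  obtain ⟨v, u, hx⟩ := h.thd x (-z) y (by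
    rw [smul_neg, ← sub_eq_zero, ← hxyz]; abel)
  have hx' : x = b • u - a • (-v) := by rw [hx]; module
  obtain ⟨t, ht⟩ := h.snd (y - c • u) (z + c • v) (by
    rw [← sub_eq_zero, ← neg_eq_zero, ← hxyz, hx]; module)
  have ht' : y = c • u - a • (-t) := by rw [sub_eq_iff_eq_add.1 ht]; module
  refine ⟨u, -v, -t, hx', ht', ?_⟩
  rw [← sub_eq_zero]
  apply h.fst
  rw [← hxyz, hx', ht']
  module

end IsRegularTriple

/-- Let `M₂ → M₁ → M₀ → R` be exact at `M₁` and `M₀`, and let the regular sequence `a, b, c`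
multiply `z` into the image of `M₀`. Lifting the three memberships successively to `M₀`, `M₁` and
`M₂` produces an element `s` of `M₂`. If `s` is a combination of `a, b, c`, the lifts can be
corrected one after the other, and `z` itself is in the image. -/
lemma exists_eq_of_regularTriple_mul_mem {R M₀ M₁ M₂ : Type*} [CommRing R]
    [AddCommGroup M₀] [Module R M₀] [AddCommGroup M₁] [Module R M₁] [AddCommGroup M₂] [Module R M₂]
    {f : M₀ →ₗ[R] R} {φ : M₁ →ₗ[R] M₀} {ψ : M₂ →ₗ[R] M₁}
    (hf : Function.Exact φ f) (hφ : Function.Exact ψ φ) {a b c y z : R}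
    (h : IsRegularTriple R a b c) (h₀ : IsRegularTriple M₀ a b c) (h₁ : IsRegularTriple M₁ a b c)
    (hy : ∀ s u v w, ψ s = a • u + b • v + c • w → ∃ u' v' w', y • s = a • u' + b • v' + c • w')
    (ha : a * z ∈ LinearMap.range f) (hb : b * z ∈ LinearMap.range f)
    (hc : c * z ∈ LinearMap.range f) : y * z ∈ LinearMap.range f := by
  obtain ⟨ua, ha⟩ := ha
  obtain ⟨ub, hb⟩ := hb
  obtain ⟨uc, hc⟩ := hc
  obtain ⟨vab, hab⟩ := (hf (b • ua - a • ub)).1 (by simp [ha, hb]; ring)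
  obtain ⟨vac, hac⟩ := (hf (c • ua - a • uc)).1 (by simp [ha, hc]; ring)
  obtain ⟨vbc, hbc⟩ := (hf (c • ub - b • uc)).1 (by simp [hb, hc]; ring)
  obtain ⟨s, hs⟩ := (hφ (c • vab - b • vac + a • vbc)).1 (by
    simp only [map_add, map_sub, map_smul, hab, hac, hbc]; module)
  obtain ⟨sbc, sac, sab, hs'⟩ := hy s vbc (-vac) vab (by rw [hs]; module)
  obtain ⟨wa, wb, wc, e1, e2, e3⟩ := h₁.exists_koszul
    (x := y • vab - ψ sab) (y := y • vac + ψ sac) (z := y • vbc - ψ sbc) (by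
      have : ψ (y • s) = y • (c • vab - b • vac + a • vbc) := by rw [map_smul, hs]
      rw [hs'] at this
      simp only [map_add, map_smul] at this
      rw [← sub_eq_zero.2 this.symm]
      module)
  have hψ (t) : φ (ψ t) = 0 := hφ.apply_apply_eq_zero t
  have hφ' (t) : f (φ t) = 0 := hf.apply_apply_eq_zero t
  have e1' := congrArg φ e1
  simp only [map_sub, map_smul, hψ, hab] at e1'
  obtain ⟨u, hu⟩ := h₀.snd (y • ua - φ wa) (y • ub - φ wb) (by
    rw [← sub_eq_zero, ← sub_eq_zero.2 e1']; module)
  refine ⟨u, ?_⟩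
  rw [← sub_eq_zero]
  apply h.fst
  have := congrArg f hu
  simp only [map_sub, map_smul, hφ', ha, smul_eq_mul] at this ⊢
  linear_combination -this

/-! ### Grade three in polynomial rings -/

/-- Every prime ideal of height at least three contains a regular sequence of length three. -/
def PrimesHaveGradeThree (R : Type*) [CommRing R] : Prop :=
  ∀ P : Ideal R, P.IsPrime → 3 ≤ P.height → ∃ a ∈ P, ∃ b ∈ P, ∃ c ∈ P, IsRegularTriple R a b c

lemma PrimesHaveGradeThree.of_ringEquiv {R R' : Type*} [CommRing R] [CommRing R'] (e : R ≃+* R')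
    (h : PrimesHaveGradeThree R) : PrimesHaveGradeThree R' := by
  intro P hP h3
  obtain ⟨a, ha, b, hb, c, hc, habc⟩ := h (P.comap e) (Ideal.IsPrime.comap _)
    (by rwa [e.height_comap])
  exact ⟨e a, ha, e b, hb, e c, hc, habc.map e⟩

/-- Unmixedness of a complete intersection `(a, b)` of codimension two. The Koszul resolution
`0 → R → R² → R` of `R ⧸ (a, b)` is too short to allow a regular sequence of length three in an
associated prime. -/
lemma PrimesHaveGradeThree.height_le_two {R : Type*} [CommRing R] [IsDomain R]
    (h : PrimesHaveGradeThree R) {a b : R} (ha : a ≠ 0) (hab : ∀ x, a ∣ b * x → a ∣ x)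
    {P : Ideal R} [P.IsPrime] {z : R} (hz : z ∉ Ideal.span {a, b})
    (hPz : ∀ p ∈ P, p * z ∈ Ideal.span {a, b}) : P.height ≤ 2 := by
  by_contra hP
  have h3 : 3 ≤ P.height := by
    have := Order.add_one_le_of_lt (not_le.1 hP)
    rwa [show (2 : ℕ∞) + 1 = 3 by norm_num] at this
  obtain ⟨p₁, h₁, p₂, h₂, p₃, h₃, hreg⟩ := h P ‹_› h3
  have hrange : ∀ x, x ∈ LinearMap.range (Fintype.linearCombination R ![a, b]) ↔
      x ∈ Ideal.span {a, b} := by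
    intro x
    rw [Ideal.mem_span_pair]
    constructor
    · rintro ⟨v, rfl⟩
      exact ⟨v 0, v 1, by simp [Fintype.linearCombination_apply]⟩
    · rintro ⟨u, v, rfl⟩
      exact ⟨![u, v], by simp [Fintype.linearCombination_apply]⟩
  have hf : Function.Exact (Fintype.linearCombination R ![![-b, a]])
      (Fintype.linearCombination R ![a, b]) := by
    intro v
    constructor
    · intro hv
      simp only [Fintype.linearCombination_apply, Fin.sum_univ_two, Matrix.cons_val_zero,
        Matrix.cons_val_one, smul_eq_mul] at hv
      obtain ⟨t, ht⟩ := hab (v 1) ⟨-v 0, by linear_combination hv⟩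
      refine ⟨![t], ?_⟩
      have h0 : v 0 = -(b * t) := by
        apply mul_left_cancel₀ ha
        rw [ht] at hv
        linear_combination hv
      funext i
      fin_cases i <;> simp [Fintype.linearCombination_apply, h0, ht, mul_comm]
    · rintro ⟨w, rfl⟩
      simp [Fintype.linearCombination_apply]
      ring
  have hφ : Function.Exact (0 : (Fin 0 → R) →ₗ[R] (Fin 1 → R))
      (Fintype.linearCombination R ![![-b, a]]) := by
    intro w
    constructor
    · intro hw
      refine ⟨0, ?_⟩
      have := congrFun hw 1
      simp [Fintype.linearCombination_apply, ha] at this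
      funext i
      fin_cases i
      simp [this]
    · rintro ⟨w, rfl⟩
      simp
  refine hz ((hrange z).1 ?_)
  have := exists_eq_of_regularTriple_mul_mem hf hφ (y := 1) (z := z) hreg (hreg.pi _) (hreg.pi _)
    (fun s _ _ _ _ => ⟨0, 0, 0, Subsingleton.elim _ _⟩) ((hrange _).2 (hPz _ h₁))
    ((hrange _).2 (hPz _ h₂)) ((hrange _).2 (hPz _ h₃))
  simpa using this

open scoped Polynomial in
/-- A prime ideal of `R[X]` has height at most one more than its contraction to `R`. -/
lemma Polynomial.height_le_height_comap_C_add_one {R : Type*} [CommRing R] [IsNoetherianRing R]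
    (P : Ideal R[X]) [P.IsPrime] : P.height ≤ (P.comap Polynomial.C).height + 1 := by
  set p := P.comap (Polynomial.C : R →+* R[X]) with hp
  have : P.LiesOver p := ⟨rfl⟩
  rw [Ideal.height_eq_height_add_of_liesOver_of_hasGoingDown p P]
  gcongr
  -- the image of `P` in `(R ⧸ p)[X]` is a prime that meets `R ⧸ p` in zero, so that its height
  -- can be computed in the principal ideal domain `K[X]`, where `K` is the fraction field
  let D := R ⧸ p
  let e : D[X] ≃+* R[X] ⧸ (p.map (algebraMap R R[X])) :=
    Ideal.polynomialQuotientEquivQuotientPolynomial p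
  set Q := P.map (Ideal.Quotient.mk (p.map (algebraMap R R[X]))) with hQ
  have hker : p.map (algebraMap R R[X]) ≤ P := Ideal.map_le_iff_le_comap.2 le_rfl
  have hQprime : Q.IsPrime := Ideal.map_isPrime_of_surjective Ideal.Quotient.mk_surjective
    (by rw [Ideal.mk_ker]; exact hker)
  rw [← e.height_comap]
  set Q' := Q.comap e
  have : Q'.IsPrime := Ideal.IsPrime.comap _
  let K := FractionRing D
  let _ : Algebra D[X] K[X] := Polynomial.algebra D K
  have : IsLocalization (Submonoid.map Polynomial.C (nonZeroDivisors D)) K[X] :=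
    Polynomial.isLocalization _ _
  have hdisj : Disjoint
      ((Submonoid.map Polynomial.C (nonZeroDivisors D) : Submonoid D[X]) : Set D[X]) Q' := by
    rw [Set.disjoint_left]
    rintro _ ⟨d, hd, rfl⟩ hdQ
    obtain ⟨r, rfl⟩ := Ideal.Quotient.mk_surjective d
    refine nonZeroDivisors.ne_zero hd (Ideal.Quotient.eq_zero_iff_mem.2 ?_)
    have h1 : e (Polynomial.C (Ideal.Quotient.mk p r)) = Ideal.Quotient.mk _ (Polynomial.C r) := by
      have := Ideal.polynomialQuotientEquivQuotientPolynomial_map_mk p (Polynomial.C r)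
      simpa [e] using! this
    have h2 : Ideal.Quotient.mk (p.map (algebraMap R R[X])) (Polynomial.C r) ∈ Q := by
      rw [← h1]; exact hdQ
    rw [hQ, Ideal.mem_quotient_iff_mem hker] at h2
    exact h2
  rw [← IsLocalization.height_map_of_disjoint (S := K[X])
    (Submonoid.map Polynomial.C (nonZeroDivisors D)) Q' hdisj]
  have hK : ringKrullDim K[X] = 1 := by simp
  have hne : Ideal.map (algebraMap D[X] K[X]) Q' ≠ ⊤ :=
    (IsLocalization.isPrime_of_isPrime_disjoint _ _ _ ‹_› hdisj).ne_top
  have := Ideal.height_le_ringKrullDim_of_ne_top hne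
  rw [hK] at this
  exact_mod_cast this

open scoped Polynomial in
lemma Polynomial.height_map_C_of_isPrime {R : Type*} [CommRing R] [IsNoetherianRing R]
    (p : Ideal R) [p.IsPrime] : (p.map (Polynomial.C : R →+* R[X])).height = p.height := by
  have : (p.map (Polynomial.C : R →+* R[X])).IsPrime := Ideal.isPrime_map_C_of_isPrime
  have : (p.map (Polynomial.C : R →+* R[X])).LiesOver p := ⟨by
    ext x
    simp only [Ideal.under_def, Ideal.mem_comap, Polynomial.algebraMap_eq]
    rw [Ideal.mem_map_C_iff]
    constructor
    · intro h n
      rw [Polynomial.coeff_C]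
      split_ifs <;> simp [h]
    · intro h
      simpa using h 0⟩
  simp [Ideal.height_eq_height_add_of_liesOver_of_hasGoingDown p]

lemma Ideal.IsPrime.exists_regular_pair {R : Type*} [CommRing R] [IsDomain R] [IsNoetherianRing R]
    [UniqueFactorizationMonoid R] {p : Ideal R} (hp : p.IsPrime) (h2 : 2 ≤ p.height) :
    ∃ a ∈ p, ∃ b ∈ p, a ≠ 0 ∧ ∀ x, a ∣ b * x → a ∣ x := by
  have hbot : p ≠ ⊥ := by
    rintro rfl
    simp at h2
  obtain ⟨a, ha, hprime⟩ := hp.exists_mem_prime_of_ne_bot hbot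
  have hle : ¬ p ≤ Ideal.span {a} := fun h => by
    have := h2.trans ((Ideal.height_mono h).trans
      (Ideal.height_span_singleton_le_one hprime.not_isUnit))
    exact absurd this (by decide)
  obtain ⟨b, hb, hba⟩ := SetLike.not_le_iff_exists.1 hle
  refine ⟨a, ha, b, hb, hprime.ne_zero, fun x hx => (hprime.dvd_or_dvd hx).resolve_left ?_⟩
  rwa [← Ideal.mem_span_singleton]

open scoped Polynomial in
/-- The step from `R` to `R[X]`. Two elements `a, b` of a regular sequence can be chosen in the
contraction `p` of `P`, and by McCoy's theorem the zero divisors modulo `(a, b)` in `R[X]` lie in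
the finitely many primes `p'[X]` with `p'` associated to `(a, b)`. These have height at most two,
so that prime avoidance gives the third element. -/
lemma PrimesHaveGradeThree.polynomial {R : Type*} [CommRing R] [IsDomain R] [IsNoetherianRing R]
    [UniqueFactorizationMonoid R] (h : PrimesHaveGradeThree R) : PrimesHaveGradeThree R[X] := by
  intro P hP h3
  have hp2 : 2 ≤ (P.comap (Polynomial.C : R →+* R[X])).height := by
    have := h3.trans (Polynomial.height_le_height_comap_C_add_one P)
    rw [show (3 : ℕ∞) = 2 + 1 by norm_num] at this
    exact (ENat.add_le_add_iff_right (by simp)).1 this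
  obtain ⟨a, ha, b, hb, ha0, hab⟩ :=
    (Ideal.IsPrime.comap (Polynomial.C : R →+* R[X])).exists_regular_pair hp2
  set I : Ideal R := Ideal.span {a, b} with hI
  set A := associatedPrimes R (R ⧸ I) with hA
  have hAfin : A.Finite := associatedPrimes.finite R _
  have hAht : ∀ p ∈ A, (p.map (Polynomial.C : R →+* R[X])).height ≤ 2 := by
    intro p hp
    obtain ⟨hpp, x, hx⟩ := isAssociatedPrime_iff.1 hp
    obtain ⟨z, rfl⟩ := Ideal.Quotient.mk_surjective x
    have hmem : ∀ r, r ∈ p ↔ r * z ∈ I := by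
      intro r
      rw [hx, Submodule.mem_colon_singleton, Submodule.mem_bot, ← Ideal.Quotient.eq_zero_iff_mem]
      rfl
    rw [Polynomial.height_map_C_of_isPrime]
    refine h.height_le_two ha0 hab (z := z) (fun hz => ?_) fun r hr => (hmem r).1 hr
    exact hpp.ne_top ((Ideal.eq_top_iff_one _).2 ((hmem 1).2 (by simpa using hz)))
  obtain ⟨c, hcP, hc⟩ : ∃ c ∈ P, ∀ p ∈ A, c ∉ p.map (Polynomial.C : R →+* R[X]) := by
    by_contra! hcon
    have hsub : (P : Set R[X]) ⊆ ⋃ p ∈ A, (p.map (Polynomial.C : R →+* R[X]) : Set R[X]) := by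
      intro c hc
      obtain ⟨p, hp, hcp⟩ := hcon c hc
      exact Set.mem_biUnion hp hcp
    rw [Ideal.subset_union_prime_finite hAfin ⊥ ⊥ (fun p hp _ _ =>
      haveI := IsAssociatedPrime.isPrime hp; Ideal.isPrime_map_C_of_isPrime)] at hsub
    obtain ⟨p, hp, hle⟩ := hsub
    exact absurd (h3.trans ((Ideal.height_mono hle).trans (hAht p hp))) (by decide)
  have hmapI : I.map (Polynomial.C : R →+* R[X]) = Ideal.span {Polynomial.C a, Polynomial.C b} := by
    rw [hI, Ideal.map_span, Set.image_pair]
  refine ⟨Polynomial.C a, ha, Polynomial.C b, hb, c, hcP, ?_, ?_, ?_⟩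
  · intro x hx
    exact (mul_eq_zero.1 hx).resolve_left (by simpa using ha0)
  · intro x y hxy
    have : (Polynomial.C a : R[X]) ∣ x := by
      rw [Polynomial.C_dvd_iff_dvd_coeff]
      intro n
      apply hab
      refine ⟨y.coeff n, ?_⟩
      simpa using congrArg (Polynomial.coeff · n) hxy
    exact this
  · intro x y z hxyz
    have hx : x ∈ I.map (Polynomial.C : R →+* R[X]) := by
      by_contra hx
      -- `c` is a zero divisor modulo `I[X]`, hence is killed by a constant outside `I`
      have hzd : c.map (Ideal.Quotient.mk I) ∉ nonZeroDivisors (R ⧸ I)[X] := by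
        intro hmem
        apply hx
        rw [Ideal.mem_map_C_iff]
        have h0 : x.map (Ideal.Quotient.mk I) * c.map (Ideal.Quotient.mk I) = 0 := by
          rw [← Polynomial.map_mul]
          ext n
          rw [Polynomial.coeff_map, Polynomial.coeff_zero, Ideal.Quotient.eq_zero_iff_mem]
          refine Ideal.mem_map_C_iff.1 (?_ : x * c ∈ I.map Polynomial.C) n
          rw [hmapI, Ideal.mem_span_pair]
          exact ⟨y, z, by simp only [smul_eq_mul] at hxyz; linear_combination -hxyz⟩
        have := (mul_right_mem_nonZeroDivisors_eq_zero_iff hmem).1 h0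
        intro n
        have := congrArg (Polynomial.coeff · n) this
        simpa [Ideal.Quotient.eq_zero_iff_mem] using this
      obtain ⟨r, hr0, hr⟩ := Polynomial.notMem_nonZeroDivisors_iff.1 hzd
      obtain ⟨p, hp, hle⟩ := exists_le_isAssociatedPrime_of_isNoetherianRing R r hr0
      refine hc p hp (Ideal.mem_map_C_iff.2 fun n => hle ?_)
      rw [Submodule.mem_colon_singleton, Submodule.mem_bot]
      have := congrArg (Polynomial.coeff · n) hr
      simp only [Polynomial.coeff_smul, Polynomial.coeff_map, Polynomial.coeff_zero,
        smul_eq_mul] at this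
      rw [Algebra.smul_def, mul_comm]
      exact this
    rw [hmapI, Ideal.mem_span_pair] at hx
    obtain ⟨u, v, rfl⟩ := hx
    exact ⟨u, v, by simp [mul_comm]⟩

theorem MvPolynomial.primesHaveGradeThree (k : Type*) [Field k] (n : ℕ) :
    PrimesHaveGradeThree (MvPolynomial (Fin n) k) := by
  induction n with
  | zero =>
    intro P hP h3
    have h := Ideal.height_le_ringKrullDim_of_ne_top hP.ne_top
    rw [show ringKrullDim (MvPolynomial (Fin 0) k) = 0 by simp] at h
    have h' : P.height ≤ 0 := by exact_mod_cast h
    exact absurd (h3.trans h') (by decide)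
  | succ n ih => exact ih.polynomial.of_ringEquiv (finSuccEquiv k n).symm.toRingEquiv

/-! ### The unmixed part -/

lemma Ideal.height_radical {R : Type*} [CommRing R] (I : Ideal R) :
    I.radical.height = I.height := by
  rw [Ideal.height_eq_inf_minimalPrimes, Ideal.height_eq_inf_minimalPrimes,
    Ideal.radical_minimalPrimes]

/-- An element lies in the unmixed part of `I` if and only if it lies in `I` locally at every prime
over `I` of the same height as `I`. -/
lemma mem_unmixedPart_iff {R : Type*} [CommRing R] [IsNoetherianRing R] {I : Ideal R}
    {z : R} :
    z ∈ unmixedPart I ↔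
      ∀ P : Ideal R, P.IsPrime → I ≤ P → P.height = I.height → ∃ s ∉ P, s * z ∈ I := by
  have hcolon : ∀ Q : Ideal R, Q.colon Set.univ = Q := fun Q => by
    ext x
    rw [Submodule.mem_colon]
    exact ⟨fun h => by simpa using h 1 trivial, fun h r _ => Q.mul_mem_right _ h⟩
  rw [unmixedPart, Submodule.mem_sInf]
  constructor
  · intro hz P hP hIP hht
    have hmin : P ∈ I.minimalPrimes := Ideal.mem_minimalPrimes_of_height_le hIP hht.le
    obtain ⟨t, ht⟩ := Submodule.IsLasker.exists_isMinimalPrimaryDecomposition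
      (Submodule.isLasker R R) I
    obtain ⟨Q, hQt, hQP⟩ :=
      Ideal.IsMinimalPrimaryDecomposition.minimalPrimes_subset_image_radical ht hmin
    have hzQ : z ∈ Q := hz Q ⟨⟨t, ht, hQt⟩, by rw [← hht, ← hQP, Ideal.height_radical]⟩
    -- the other components of the decomposition are not contained in `P`
    have hnle : ¬ (t.erase Q).inf id ≤ P := by
      intro hle
      obtain ⟨Q', hQ', hle'⟩ := (Ideal.IsPrime.inf_le' hP).1 hle
      obtain ⟨hne, hQ't⟩ := Finset.mem_erase.1 hQ'
      refine ht.distinct hQ't hQt hne ?_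
      simp only [hcolon]
      refine (le_antisymm (hP.radical_le_iff.2 hle') (hmin.2
        ⟨Ideal.isPrime_radical (ht.primary hQ't),
          ht.inf_eq.symm.trans_le ((Finset.inf_le hQ't).trans Ideal.le_radical)⟩
        (hP.radical_le_iff.2 hle'))).trans hQP.symm
    obtain ⟨s, hs, hsP⟩ := SetLike.not_le_iff_exists.1 hnle
    refine ⟨s, hsP, ?_⟩
    rw [← ht.inf_eq, ← Finset.insert_erase hQt, Finset.inf_insert]
    exact ⟨Q.mul_mem_left _ hzQ, Ideal.mul_mem_right _ _ hs⟩
  · rintro h Q ⟨⟨t, ht, hQt⟩, hht⟩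
    have hIQ : I ≤ Q := ht.inf_eq.symm.trans_le (Finset.inf_le hQt)
    obtain ⟨s, hs, hsz⟩ := h (Ideal.radical Q) (Ideal.isPrime_radical (ht.primary hQt))
      (hIQ.trans Ideal.le_radical) (by rw [Ideal.height_radical, hht])
    refine ((Ideal.isPrimary_iff.1 (ht.primary hQt)).2 (x := z) (y := s) ?_).resolve_right hs
    rw [mul_comm]
    exact hIQ hsz

lemma le_unmixedPart {R : Type*} [CommRing R] (I : Ideal R) : I ≤ unmixedPart I :=
  le_sInf fun _ ⟨⟨_, ht, hQt⟩, _⟩ => ht.inf_eq.symm.trans_le (Finset.inf_le hQt)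

lemma mem_associatedPrimes_quotient_iff {R : Type*} [CommRing R] [IsNoetherianRing R]
    {I P : Ideal R} :
    P ∈ associatedPrimes R (R ⧸ I) ↔ P.IsPrime ∧ ∃ z, ∀ r, r ∈ P ↔ r * z ∈ I := by
  have key : ∀ z r : R,
      r ∈ (⊥ : Submodule R (R ⧸ I)).colon {Ideal.Quotient.mk I z} ↔ r * z ∈ I := by
    intro z r
    rw [Submodule.mem_colon_singleton, Submodule.mem_bot, ← Ideal.Quotient.eq_zero_iff_mem]
    rfl
  rw [AssociatedPrimes.mem_iff, isAssociatedPrime_iff]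
  refine and_congr_right fun _ => ⟨?_, ?_⟩
  · rintro ⟨x, rfl⟩
    obtain ⟨z, rfl⟩ := Ideal.Quotient.mk_surjective x
    exact ⟨z, key z⟩
  · rintro ⟨z, hz⟩
    exact ⟨Ideal.Quotient.mk I z, Ideal.ext fun r => (hz r).trans (key z r).symm⟩

/-- An element outside `I` has a multiple whose annihilator modulo `I` is an associated prime. -/
lemma exists_mem_associatedPrimes_quotient {R : Type*} [CommRing R] [IsNoetherianRing R]
    {I : Ideal R} {z : R} (hz : z ∉ I) :
    ∃ P ∈ associatedPrimes R (R ⧸ I), ∀ r, r * z ∈ I → r ∈ P := by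
  obtain ⟨P, hP, hle⟩ := exists_le_isAssociatedPrime_of_isNoetherianRing R
    (Ideal.Quotient.mk I z) (by rwa [Ne, Ideal.Quotient.eq_zero_iff_mem])
  refine ⟨P, hP, fun r hr => hle ?_⟩
  rw [Submodule.mem_colon_singleton, Submodule.mem_bot, ← Ideal.Quotient.eq_zero_iff_mem.2 hr]
  rfl

section

variable {R : Type*} [CommRing R] {l₀ l₁ l₂ q h : R}

lemma mul_mem_of_mem_span_triple {r : R} (hr : r ∈ Ideal.span {l₀, l₁, l₂}) {z : R}
    (hz : z ∈ Ideal.span {q, h}) : r * z ∈ Ideal.span {q * l₀, q * l₁, q * l₂, h} := by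
  obtain ⟨u, v, rfl⟩ := Ideal.mem_span_pair.1 hz
  rw [mul_add]
  refine add_mem ?_ (Ideal.mul_mem_left _ _ (Ideal.mul_mem_left _ _
    (Ideal.subset_span (by simp))))
  rw [mul_left_comm]
  refine Ideal.mul_mem_left _ _ ?_
  induction hr using Submodule.span_induction with
  | mem x hx =>
    rw [mul_comm x q]
    rcases hx with rfl | rfl | rfl <;> exact Ideal.subset_span (by simp)
  | zero => simp
  | add x y _ _ hx hy => rw [add_mul]; exact add_mem hx hy
  | smul a x _ hx => rw [smul_eq_mul, mul_assoc]; exact Ideal.mul_mem_left _ _ hx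

lemma span_le_span_pair : Ideal.span {q * l₀, q * l₁, q * l₂, h} ≤ Ideal.span {q, h} := by
  have hq : q ∈ Ideal.span {q, h} := Ideal.subset_span (by simp)
  rw [Ideal.span_le]
  rintro x (rfl | rfl | rfl | rfl)
  · exact Ideal.mul_mem_right _ _ hq
  · exact Ideal.mul_mem_right _ _ hq
  · exact Ideal.mul_mem_right _ _ hq
  · exact Ideal.subset_span (by simp)

/-- The ideals `(q l₀, q l₁, q l₂, h)` and `(q, h)` agree locally at all primes that do not contain
`(l₀, l₁, l₂)`, in particular at those of height two. -/
theorem unmixedPart_eq_span_pair [IsDomain R] [IsNoetherianRing R]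
    (hR : PrimesHaveGradeThree R)
    (hL : (Ideal.span {l₀, l₁, l₂}).height = 3) (hq : q ≠ 0) (hqh : ∀ x, q ∣ h * x → q ∣ x)
    (hJ : (Ideal.span {q * l₀, q * l₁, q * l₂, h}).height = 2) :
    unmixedPart (Ideal.span {q * l₀, q * l₁, q * l₂, h}) = Ideal.span {q, h} := by
  refine le_antisymm (fun z hz => ?_) fun z hz => ?_
  · rw [mem_unmixedPart_iff] at hz
    by_contra hzq
    obtain ⟨P, hP, hzP⟩ := exists_mem_associatedPrimes_quotient hzq
    obtain ⟨hPprime, w, hw⟩ := mem_associatedPrimes_quotient_iff.1 hP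
    have hle : Ideal.span {q * l₀, q * l₁, q * l₂, h} ≤ P := fun x hx =>
      (hw x).2 (Ideal.mul_mem_right _ _ (span_le_span_pair hx))
    have hw' : w ∉ Ideal.span {q, h} := fun hmem =>
      hPprime.ne_top ((Ideal.eq_top_iff_one _).2 ((hw 1).2 (by simpa using hmem)))
    have h2 : P.height ≤ 2 := hR.height_le_two hq hqh hw' fun r hr => (hw r).1 hr
    obtain ⟨s, hs, hsz⟩ := hz P hPprime hle
      (le_antisymm (h2.trans hJ.ge) (Ideal.height_mono hle))
    exact hs (hzP s (span_le_span_pair hsz))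
  · rw [mem_unmixedPart_iff]
    intro P hP _ hht
    have hnle : ¬ Ideal.span {l₀, l₁, l₂} ≤ P := fun hle => by
      have := Ideal.height_mono hle
      rw [hL, hht, hJ] at this
      exact absurd this (by decide)
    obtain ⟨s, hs, hsP⟩ := SetLike.not_le_iff_exists.1 hnle
    exact ⟨s, hsP, mul_mem_of_mem_span_triple hs hz⟩

/-- The annihilator of `q` modulo `(q l₀, q l₁, q l₂, h)` is `(l₀, l₁, l₂)`, and an associated prime
that does not come from a multiple of `q` modulo `h` is associated to `(q, h)`, hence has height at
most two. -/
theorem associatedPrimes_height_three_eq [IsDomain R] [IsNoetherianRing R]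
    (hR : PrimesHaveGradeThree R)
    (hLprime : (Ideal.span {l₀, l₁, l₂}).IsPrime)
    (hL : (Ideal.span {l₀, l₁, l₂}).height = 3) (hq : q ≠ 0) (hqh : ∀ x, q ∣ h * x → q ∣ x)
    (hhL : h ∈ Ideal.span {l₀, l₁, l₂}) :
    {P : Ideal R | P ∈ associatedPrimes R (R ⧸ Ideal.span {q * l₀, q * l₁, q * l₂, h}) ∧
      P.height = 3} = {Ideal.span {l₀, l₁, l₂}} := by
  ext P
  simp only [Set.mem_ofPred_eq, Set.mem_singleton_iff]
  constructor
  · rintro ⟨hP, hht⟩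
    obtain ⟨hPprime, w, hw⟩ := mem_associatedPrimes_quotient_iff.1 hP
    by_cases hwq : w ∈ Ideal.span {q, h}
    · have hle : Ideal.span {l₀, l₁, l₂} ≤ P := fun r hr =>
        (hw r).2 (mul_mem_of_mem_span_triple hr hwq)
      have : (Ideal.span {l₀, l₁, l₂}).FiniteHeight := ⟨Or.inr (by simp [hL])⟩
      exact (Ideal.eq_of_le_of_height_le _ hle (by rw [hht, hL])).symm
    · have h2 : P.height ≤ 2 := hR.height_le_two hq hqh hwq fun r hr =>
        span_le_span_pair ((hw r).1 hr)
      rw [hht] at h2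
      exact absurd h2 (by decide)
  · rintro rfl
    refine ⟨mem_associatedPrimes_quotient_iff.2 ⟨hLprime, q, fun r => ⟨fun hr =>
      mul_mem_of_mem_span_triple hr (Ideal.subset_span (by simp)), fun hr => ?_⟩⟩, hL⟩
    simp only [Ideal.mem_span_insert, Ideal.mem_span_singleton'] at hr
    obtain ⟨a, _, ⟨b, _, ⟨c, _, ⟨e, rfl⟩, rfl⟩, rfl⟩, heq⟩ := hr
    obtain ⟨e', rfl⟩ := hqh e ⟨r - a * l₀ - b * l₁ - c * l₂, by linear_combination -heq⟩
    have : r = a * l₀ + b * l₁ + c * l₂ + e' * h := by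
      apply mul_left_cancel₀ hq
      linear_combination heq
    rw [this]
    have h0 : l₀ ∈ Ideal.span {l₀, l₁, l₂} := Ideal.subset_span (by simp)
    have h1 : l₁ ∈ Ideal.span {l₀, l₁, l₂} := Ideal.subset_span (by simp)
    have h2 : l₂ ∈ Ideal.span {l₀, l₁, l₂} := Ideal.subset_span (by simp)
    exact add_mem (add_mem (add_mem (Ideal.mul_mem_left _ _ h0) (Ideal.mul_mem_left _ _ h1))
      (Ideal.mul_mem_left _ _ h2)) (Ideal.mul_mem_left _ _ hhL)

end

/-! ### Linear forms and linear changes of variables -/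

section LinearForms

variable {k : Type*} [Field k]

lemma MvPolynomial.IsHomogeneous.eq_sum_linear {σ : Type*} [Fintype σ] {p : MvPolynomial σ k}
    (hp : p.IsHomogeneous 1) : p = ∑ j, C (coeff (Finsupp.single j 1) p) * X j := by
  classical
  rw [← mem_homogeneousSubmodule, homogeneousSubmodule_one_eq_span_X] at hp
  induction hp using Submodule.span_induction with
  | mem x hx =>
    obtain ⟨i, rfl⟩ := hx
    rw [Finset.sum_eq_single i] <;>
      simp +contextual [coeff_X, Finsupp.single_left_inj, eq_comm]
  | zero => simp
  | add x y _ _ hx hy => simp only [coeff_add, C_add, add_mul, Finset.sum_add_distrib, ← hx, ← hy]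
  | smul a x _ hx =>
    conv_lhs => rw [hx, Finset.smul_sum]
    refine Finset.sum_congr rfl fun j _ => ?_
    rw [smul_eq_C_mul, coeff_smul, smul_eq_mul, map_mul, mul_assoc]

lemma MvPolynomial.coeff_single_X_mul {σ : Type*} [DecidableEq σ] (i j : σ) (p : MvPolynomial σ k) :
    coeff (Finsupp.single j 1) (X i * p) = if i = j then coeff 0 p else 0 := by
  rw [coeff_X_mul']
  by_cases h : i = j
  · subst h; simp
  · simp [h]

/-- The substitution `X i ↦ ∑ j, M i j X j`. -/
noncomputable def linearSubst {σ : Type*} [Fintype σ] (M : Matrix σ σ k) :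
    MvPolynomial σ k →ₐ[k] MvPolynomial σ k :=
  aeval fun i => ∑ j, C (M i j) * X j

lemma linearSubst_X {σ : Type*} [Fintype σ] (M : Matrix σ σ k) (i : σ) :
    linearSubst M (X i) = ∑ j, C (M i j) * X j := by
  simp [linearSubst]

lemma linearSubst_comp {σ : Type*} [Fintype σ] (M N : Matrix σ σ k) :
    (linearSubst M).comp (linearSubst N) = linearSubst (N * M) := by
  refine algHom_ext fun i => ?_
  have hC (c : k) : linearSubst M (C c) = C c := (linearSubst M).commutes c
  simp only [AlgHom.comp_apply, linearSubst_X, map_sum, map_mul, hC, Matrix.mul_apply,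
    Finset.mul_sum, Finset.sum_mul]
  rw [Finset.sum_comm]
  simp only [mul_assoc]

lemma linearSubst_one {σ : Type*} [Fintype σ] [DecidableEq σ] :
    linearSubst (1 : Matrix σ σ k) = AlgHom.id k _ := by
  refine algHom_ext fun i => ?_
  rw [linearSubst_X, Finset.sum_eq_single i] <;> simp +contextual [eq_comm]

lemma isHomogeneous_linearSubst_X {σ : Type*} [Fintype σ] (M : Matrix σ σ k) (i : σ) :
    (linearSubst M (X i)).IsHomogeneous 1 := by
  rw [linearSubst_X]
  exact IsHomogeneous.sum _ _ _ fun j _ => isHomogeneous_C_mul_X _ _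

lemma exists_isLinearChange_of_isUnit {σ : Type*} [Fintype σ] [DecidableEq σ] {M : Matrix σ σ k}
    (hM : IsUnit M) : ∃ τ : MvPolynomial σ k ≃ₐ[k] MvPolynomial σ k, IsLinearChange τ ∧
      IsLinearChange τ.symm ∧ ∀ i, τ (∑ j, C (M i j) * X j) = X i := by
  have hdet := (Matrix.isUnit_iff_isUnit_det M).1 hM
  let τ : MvPolynomial σ k ≃ₐ[k] MvPolynomial σ k := AlgEquiv.ofAlgHom (linearSubst M⁻¹)
    (linearSubst M) (by rw [linearSubst_comp, Matrix.mul_nonsing_inv _ hdet, linearSubst_one])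
    (by rw [linearSubst_comp, Matrix.nonsing_inv_mul _ hdet, linearSubst_one])
  refine ⟨τ, fun i => isHomogeneous_linearSubst_X _ i, fun i => isHomogeneous_linearSubst_X _ i,
    fun i => ?_⟩
  rw [← linearSubst_X]
  exact τ.apply_symm_apply (X i)

lemma IsLinearChange.isHomogeneous {σ : Type*} {τ : MvPolynomial σ k ≃ₐ[k] MvPolynomial σ k}
    (hτ : IsLinearChange τ) {p : MvPolynomial σ k} {n : ℕ} (hp : p.IsHomogeneous n) :
    (τ p).IsHomogeneous n := by
  have h : (τ : MvPolynomial σ k →ₐ[k] MvPolynomial σ k) = aeval fun i => τ (X i) :=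
    algHom_ext fun i => by simp
  have h' : τ p = aeval (fun i => τ (X i)) p := by rw [← h]; rfl
  rw [h', ← one_mul n]
  exact hp.aeval _ hτ

/-- Three linearly independent vectors of `k⁴` are the first rows of an invertible matrix. -/
lemma exists_isUnit_rows_eq {v : Fin 3 → Fin 4 → k} (hv : LinearIndependent k v) :
    ∃ M : Matrix (Fin 4) (Fin 4) k, IsUnit M ∧ ∀ i : Fin 3, M i.castSucc = v i := by
  obtain ⟨w, hw⟩ := exists_linearIndependent_snoc_of_lt_finrank hv (by simp)
  refine ⟨(Fin.snoc v w : Fin 4 → Fin 4 → k), Matrix.linearIndependent_rows_iff_isUnit.1 hw,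
    fun i => ?_⟩
  exact Fin.snoc_castSucc (α := fun _ => Fin 4 → k) w v i

lemma exists_isUnit_last_row_eq {c : Fin 4 → k} (hc : c ≠ 0) :
    ∃ M : Matrix (Fin 4) (Fin 4) k, IsUnit M ∧ M 3 = c := by
  have h1 : LinearIndependent k ![c] := LinearIndependent.of_subsingleton (v := ![c]) 0 hc
  obtain ⟨c₂, h2⟩ := exists_linearIndependent_cons_of_lt_finrank h1 (by simp)
  obtain ⟨c₁, h3⟩ := exists_linearIndependent_cons_of_lt_finrank h2 (by simp)
  obtain ⟨c₀, h4⟩ := exists_linearIndependent_cons_of_lt_finrank h3 (by simp)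
  exact ⟨_, Matrix.linearIndependent_rows_iff_isUnit.1 h4, rfl⟩

lemma linearIndependent_coeff_of_linearForms {n : ℕ} {l : Fin n → MvPolynomial (Fin 4) k}
    (hl : ∀ i, (l i).IsHomogeneous 1) (hind : ∀ c : Fin n → k, ∑ i, C (c i) * l i = 0 → c = 0) :
    LinearIndependent k fun i j => coeff (Finsupp.single j 1) (l i) := by
  rw [Fintype.linearIndependent_iff]
  intro c hc
  refine congrFun (hind c ?_)
  have : (∑ i, C (c i) * l i).IsHomogeneous 1 :=
    IsHomogeneous.sum _ _ _ fun i _ => (hl i).C_mul _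
  rw [this.eq_sum_linear]
  refine Finset.sum_eq_zero fun j _ => ?_
  have := congrFun hc j
  simp only [Finset.sum_apply, Pi.smul_apply, smul_eq_mul, Pi.zero_apply] at this
  simp [coeff_sum, coeff_C_mul, this]

/-- Four linearly independent linear forms become the variables. -/
lemma exists_isLinearChange_four {l : Fin 4 → MvPolynomial (Fin 4) k}
    (hl : ∀ i, (l i).IsHomogeneous 1) (hind : ∀ c : Fin 4 → k, ∑ i, C (c i) * l i = 0 → c = 0) :
    ∃ τ : MvPolynomial (Fin 4) k ≃ₐ[k] MvPolynomial (Fin 4) k, IsLinearChange τ ∧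
      IsLinearChange τ.symm ∧ ∀ i, τ (l i) = X i := by
  obtain ⟨τ, h1, h2, h3⟩ := exists_isLinearChange_of_isUnit
    (Matrix.linearIndependent_rows_iff_isUnit.1 (linearIndependent_coeff_of_linearForms hl hind))
  refine ⟨τ, h1, h2, fun i => ?_⟩
  rw [← h3 i]
  exact congrArg τ (hl i).eq_sum_linear

/-- Three linearly independent linear forms become the first three variables. -/
lemma exists_isLinearChange_three {l : Fin 3 → MvPolynomial (Fin 4) k}
    (hl : ∀ i, (l i).IsHomogeneous 1) (hind : ∀ c : Fin 3 → k, ∑ i, C (c i) * l i = 0 → c = 0) :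
    ∃ τ : MvPolynomial (Fin 4) k ≃ₐ[k] MvPolynomial (Fin 4) k, IsLinearChange τ ∧
      IsLinearChange τ.symm ∧ ∀ i : Fin 3, τ (l i) = X i.castSucc := by
  obtain ⟨M, hM, hMl⟩ := exists_isUnit_rows_eq (linearIndependent_coeff_of_linearForms hl hind)
  obtain ⟨τ, h1, h2, h3⟩ := exists_isLinearChange_of_isUnit hM
  refine ⟨τ, h1, h2, fun i => ?_⟩
  rw [← h3, hMl]
  exact congrArg τ (hl i).eq_sum_linear

lemma isPrime_span_X_image {σ : Type*} (s : Set σ) :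
    (Ideal.span (X '' s : Set (MvPolynomial σ k))).IsPrime := by
  classical
  -- the ideal is the kernel of the substitution that sends the variables in `s` to zero
  let g : MvPolynomial σ k →ₐ[k] MvPolynomial σ k := aeval fun i => if i ∈ s then 0 else X i
  have hg : Ideal.span (X '' s : Set (MvPolynomial σ k)) = RingHom.ker g := by
    apply le_antisymm
    · rw [Ideal.span_le]
      rintro _ ⟨i, hi, rfl⟩
      simp [g, RingHom.mem_ker, hi]
    · intro p hp
      have hmk : ((Ideal.Quotient.mkₐ k (Ideal.span (X '' s))).comp g) =
          Ideal.Quotient.mkₐ k (Ideal.span (X '' s)) := by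
        refine algHom_ext fun i => ?_
        by_cases hi : i ∈ s
        · have : Ideal.Quotient.mk (Ideal.span (X '' s : Set (MvPolynomial σ k))) (X i) = 0 :=
            Ideal.Quotient.eq_zero_iff_mem.2 (Ideal.subset_span ⟨i, hi, rfl⟩)
          simp [g, hi, this]
        · simp [g, hi]
      have := congrArg (fun φ => φ p) hmk
      simp only [AlgHom.comp_apply, (RingHom.mem_ker).1 hp, map_zero] at this
      exact Ideal.Quotient.eq_zero_iff_mem.1 this.symm
  rw [hg]
  exact RingHom.ker_isPrime _

lemma X_mem_span_X_image_iff {σ : Type*} {s : Set σ} {i : σ} :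
    X i ∈ Ideal.span (X '' s : Set (MvPolynomial σ k)) ↔ i ∈ s := by
  classical
  refine ⟨fun h => ?_, fun h => Ideal.subset_span ⟨i, h, rfl⟩⟩
  obtain ⟨j, hj, hne⟩ := mem_ideal_span_X_image.1 h (Finsupp.single i 1) (by simp [support_X])
  rw [Finsupp.single_apply] at hne
  split_ifs at hne with h
  · rwa [h]
  · simp at hne

lemma isRegularTriple_X {σ : Type*} {i j m : σ} (hij : i ≠ j) (him : i ≠ m) (hjm : j ≠ m) :
    IsRegularTriple (MvPolynomial σ k) (X i : MvPolynomial σ k) (X j) (X m) where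
  fst x hx := (mul_eq_zero.1 hx).resolve_left (X_ne_zero i)
  snd x y hxy := by
    have hp := isPrime_span_X_image (k := k) ({i} : Set σ)
    have hx : x ∈ Ideal.span (X '' ({i} : Set σ)) := by
      refine (hp.mem_or_mem (x := X j) (y := x) ?_).resolve_left fun h =>
        hij (X_mem_span_X_image_iff.1 h).symm
      rw [← smul_eq_mul, hxy, smul_eq_mul]
      exact Ideal.mul_mem_right _ _ (Ideal.subset_span ⟨i, rfl, rfl⟩)
    rw [Set.image_singleton, Ideal.mem_span_singleton] at hx
    exact hx
  thd x y z hxyz := by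
    have hp := isPrime_span_X_image (k := k) ({i, j} : Set σ)
    have hx : x ∈ Ideal.span (X '' ({i, j} : Set σ)) := by
      refine (hp.mem_or_mem (x := X m) (y := x) ?_).resolve_left fun h => ?_
      · rw [← smul_eq_mul, hxyz]
        exact add_mem (Ideal.mul_mem_right _ _ (Ideal.subset_span ⟨i, by simp, rfl⟩))
          (Ideal.mul_mem_right _ _ (Ideal.subset_span ⟨j, by simp, rfl⟩))
      · rcases X_mem_span_X_image_iff.1 h with h | h
        · exact him h.symm
        · exact hjm h.symm
    rw [Set.image_pair, Ideal.mem_span_pair] at hx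
    obtain ⟨u, v, rfl⟩ := hx
    exact ⟨u, v, by simp [mul_comm]⟩

lemma height_span_X_three {σ : Type*} [Finite σ] {i j m : σ} (hij : i ≠ j) (him : i ≠ m)
    (hjm : j ≠ m) :
    (Ideal.span {X i, X j, X m} : Ideal (MvPolynomial σ k)).height = 3 := by
  have h1 := isPrime_span_X_image (k := k) ({i} : Set σ)
  have h2 := isPrime_span_X_image (k := k) ({i, j} : Set σ)
  have h3 := isPrime_span_X_image (k := k) ({i, j, m} : Set σ)
  have himage : (X '' ({i, j, m} : Set σ) : Set (MvPolynomial σ k)) = {X i, X j, X m} := by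
    simp [Set.image_insert_eq]
  have hcard : ({i, j, m} : Set σ).ncard ≤ 3 := by
    have := Set.ncard_insert_le i {j, m}
    have := Set.ncard_insert_le j {m}
    rw [Set.ncard_singleton] at this
    omega
  rw [← himage]
  apply le_antisymm
  · refine (Ideal.height_le_card_of_mem_minimalPrimes_span
      (Set.toFinite (X '' ({i, j, m} : Set σ) : Set (MvPolynomial σ k)))
      (p := Ideal.span (X '' ({i, j, m} : Set σ)))
      (by rw [Ideal.minimalPrimes_eq_subsingleton_self]; rfl)).trans ?_
    exact_mod_cast (Set.ncard_image_le (Set.toFinite _)).trans hcard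
  · have e0 : (⊥ : Ideal (MvPolynomial σ k)) < Ideal.span (X '' ({i} : Set σ)) := by
      rw [bot_lt_iff_ne_bot, Ne, Submodule.eq_bot_iff]
      exact fun h => X_ne_zero (R := k) i (h _ (X_mem_span_X_image_iff.2 rfl))
    have e1 : Ideal.span (X '' ({i} : Set σ)) <
        (Ideal.span (X '' ({i, j} : Set σ)) : Ideal (MvPolynomial σ k)) := by
      refine lt_of_le_of_ne (Ideal.span_mono (Set.image_mono (by simp))) fun h => ?_
      have : X j ∈ Ideal.span (X '' ({i} : Set σ) : Set (MvPolynomial σ k)) := by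
        rw [h]; exact X_mem_span_X_image_iff.2 (by simp)
      exact hij (X_mem_span_X_image_iff.1 this).symm
    have e2 : Ideal.span (X '' ({i, j} : Set σ)) <
        (Ideal.span (X '' ({i, j, m} : Set σ)) : Ideal (MvPolynomial σ k)) := by
      refine lt_of_le_of_ne (Ideal.span_mono (Set.image_mono
        (Set.insert_subset_insert (by simp)))) fun h => ?_
      have : X m ∈ Ideal.span (X '' ({i, j} : Set σ) : Set (MvPolynomial σ k)) := by
        rw [h]; exact X_mem_span_X_image_iff.2 (by simp)
      rcases X_mem_span_X_image_iff.1 this with h | h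
      · exact him h.symm
      · exact hjm h.symm
    have a0 := Ideal.height_add_one_le_of_lt_of_isPrime e0
    have a1 := Ideal.height_add_one_le_of_lt_of_isPrime e1
    have a2 := Ideal.height_add_one_le_of_lt_of_isPrime e2
    rw [Ideal.height_bot, zero_add] at a0
    calc (3 : ℕ∞) = 1 + 1 + 1 := by norm_num
      _ ≤ _ := (add_le_add_left ((add_le_add_left a0 1).trans a1) 1).trans a2

/-- The linear syzygies of `X 0, X 1, X 2` are combinations of the three Koszul syzygies with
coefficients in `k`. -/
lemma exists_eq_koszul_of_linear_syzygy_X {r₀ r₁ r₂ : MvPolynomial (Fin 4) k}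
    (h₀ : r₀.IsHomogeneous 1) (h₁ : r₁.IsHomogeneous 1) (h₂ : r₂.IsHomogeneous 1)
    (h : r₀ * X 0 + r₁ * X 1 + r₂ * X 2 = 0) :
    ∃ c₀ c₁ c₂ : k, r₀ = C c₂ * X 1 - C c₁ * X 2 ∧ r₁ = C c₀ * X 2 - C c₂ * X 0 ∧
      r₂ = C c₁ * X 0 - C c₀ * X 1 := by
  obtain ⟨u, v, w, hu, hv, hw⟩ := (isRegularTriple_X (k := k) (σ := Fin 4) (i := 0) (j := 1)
    (m := 2) (by decide) (by decide) (by decide)).exists_koszul (x := r₂) (y := -r₁) (z := r₀)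
    (by simp only [smul_eq_mul]; linear_combination h)
  refine ⟨-coeff 0 u, -coeff 0 v, -coeff 0 w, ?_, ?_, ?_⟩
  · rw [h₀.eq_sum_linear, hw]
    simp [Fin.sum_univ_four, coeff_single_X_mul]
  · rw [h₁.eq_sum_linear, ← neg_neg r₁, hv]
    simp [Fin.sum_univ_four, coeff_single_X_mul]
    ring
  · rw [h₂.eq_sum_linear, hu]
    simp [Fin.sum_univ_four, coeff_single_X_mul]

end LinearForms

/-! ### The matrices of the resolution -/

section Resolution

variable {k : Type*} [Field k]

lemma isHomogeneous_of_support_degree {σ : Type*} {p : MvPolynomial σ k} {e : ℤ} {n : ℕ}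
    (h : ∀ m ∈ p.support, (m.degree : ℤ) = e) (he : e = n) : p.IsHomogeneous n := by
  intro m hm
  have := h m (mem_support_iff.2 hm)
  rw [he] at this
  rw [Nat.cast_inj, Finsupp.degree_eq_weight_one] at this
  exact this

lemma eq_zero_of_support_degree_le_zero {σ : Type*} {p : MvPolynomial σ k} {e : ℤ}
    (h : ∀ m ∈ p.support, (m.degree : ℤ) = e) (he : e ≤ 0)
    (hp : p ∈ Ideal.span (Set.range (X : σ → MvPolynomial σ k))) : p = 0 := by
  rw [← support_eq_empty, Finset.eq_empty_iff_forall_notMem]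
  intro m hm
  have h0 : m.degree = 0 := by have := h m hm; omega
  rw [← Set.image_univ] at hp
  obtain ⟨i, -, hi⟩ := mem_ideal_span_X_image.1 hp m hm
  exact hi (by rw [(Finsupp.degree_eq_zero_iff m).1 h0]; rfl)

lemma eq_zero_of_C_mem_span_X {σ : Type*} {c : k}
    (h : C c ∈ Ideal.span (Set.range (X : σ → MvPolynomial σ k))) : c = 0 := by
  have hle : Ideal.span (Set.range (X : σ → MvPolynomial σ k)) ≤
      RingHom.ker (constantCoeff (σ := σ) (R := k)) := by
    rw [Ideal.span_le]
    rintro _ ⟨i, rfl⟩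
    simp [RingHom.mem_ker]
  simpa [RingHom.mem_ker] using hle h

/-- A divisor of at least the same degree differs by a scalar. -/
lemma exists_eq_C_mul_of_dvd {σ : Type*} {p q : MvPolynomial σ k} (hqp : q ∣ p)
    (hdeg : p.totalDegree ≤ q.totalDegree) : ∃ c : k, p = C c * q := by
  obtain ⟨e, rfl⟩ := hqp
  by_cases hq : q = 0
  · exact ⟨0, by simp [hq]⟩
  by_cases he : e = 0
  · exact ⟨0, by simp [he]⟩
  rw [totalDegree_mul_of_isDomain hq he] at hdeg
  have : e.totalDegree = 0 := by omega
  rw [totalDegree_eq_zero_iff_eq_C] at this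
  exact ⟨_, by rw [mul_comm]; nth_rw 1 [this]⟩

lemma MvPolynomial.IsHomogeneous.prime_of_one {σ : Type*} {p : MvPolynomial σ k}
    (hp : p.IsHomogeneous 1) (h0 : p ≠ 0) : Prime p := by
  refine (irreducible_of_totalDegree_eq_one (hp.totalDegree h0) fun x hx => ?_).prime
  rw [isUnit_iff_ne_zero]
  rintro rfl
  exact h0 (MvPolynomial.ext _ _ fun m => by simpa using hx m)

namespace IsMinimalGradedResolution

variable {σ ι₀ ι₁ ι₂ : Type*} [Fintype ι₀] [Fintype ι₁] [Fintype ι₂]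
  {J : Ideal (MvPolynomial σ k)} {a₀ : ι₀ → ℤ} {a₁ : ι₁ → ℤ} {a₂ : ι₂ → ℤ}
  {f : ι₀ → MvPolynomial σ k} {φ : Matrix ι₀ ι₁ (MvPolynomial σ k)}
  {ψ : Matrix ι₁ ι₂ (MvPolynomial σ k)}

lemma sum_mul_φ_eq_zero (h : IsMinimalGradedResolution J a₀ a₁ a₂ f φ ψ) (j : ι₁) :
    ∑ i, f i * φ i j = 0 := by
  classical
  have := h.exact_φ_f.apply_apply_eq_zero (Pi.single j 1)
  simpa [Fintype.linearCombination_apply, mul_comm] using this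

lemma sum_φ_mul_ψ_eq_zero (h : IsMinimalGradedResolution J a₀ a₁ a₂ f φ ψ) (i : ι₀) (j : ι₂) :
    ∑ m, φ i m * ψ m j = 0 := by
  classical
  have := congrFun (h.exact_ψ_φ.apply_apply_eq_zero (Pi.single j 1)) i
  simpa [Matrix.mulVec, dotProduct] using this

lemma exists_eq_φ_mulVec (h : IsMinimalGradedResolution J a₀ a₁ a₂ f φ ψ)
    {v : ι₀ → MvPolynomial σ k} (hv : ∑ i, v i * f i = 0) : ∃ w, φ.mulVec w = v :=
  (h.exact_φ_f v).1 (by simpa [Fintype.linearCombination_apply] using hv)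

/-- The generators are linearly independent over `k`, by minimality. -/
lemma eq_zero_of_sum_C_mul_f (h : IsMinimalGradedResolution J a₀ a₁ a₂ f φ ψ) {c : ι₀ → k}
    (hc : ∑ i, C (c i) * f i = 0) : c = 0 := by
  obtain ⟨w, hw⟩ := h.exists_eq_φ_mulVec hc
  funext i
  apply eq_zero_of_C_mem_span_X (σ := σ)
  rw [← congrFun hw i]
  exact Ideal.sum_mem _ fun j _ => Ideal.mul_mem_right _ _ (h.minimal_φ i j)

/-- The columns of `φ` are linearly independent over `k`, by minimality. -/
lemma eq_zero_of_φ_mulVec_C (h : IsMinimalGradedResolution J a₀ a₁ a₂ f φ ψ) {c : ι₁ → k}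
    (hc : ∀ i, ∑ j, φ i j * C (c j) = 0) : c = 0 := by
  obtain ⟨s, hs⟩ := (h.exact_ψ_φ fun j => C (c j)).1 (funext hc)
  funext j
  apply eq_zero_of_C_mem_span_X (σ := σ)
  rw [← congrFun hs j]
  exact Ideal.sum_mem _ fun m _ => Ideal.mul_mem_right _ _ (h.minimal_ψ j m)

/-- The entries of a single column `ψ` are not combinations of two linear forms `m₀`, `m₁` with
independent coefficient vectors `u`, `v`. Indeed `(φ u) m₀ + (φ v) m₁ = 0`. If `m₀` and `m₁` are
proportional, this is a linear relation between the columns of `φ`. Otherwise `φ u` is `m₁` times a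
vector `α` of scalars, which is a relation between the generators, so that `α = 0` and `φ u = 0`.
Minimality excludes both. -/
lemma false_of_ψ_eq_two_linearForms {ψ : Matrix ι₁ (Fin 1) (MvPolynomial σ k)} {a₂ : Fin 1 → ℤ}
    (h : IsMinimalGradedResolution J a₀ a₁ a₂ f φ ψ)
    {u v : ι₁ → k} {m₀ m₁ : MvPolynomial σ k} (hu : u ≠ 0) (huv : ∀ γ : k, γ • u + v ≠ 0)
    (h₀ : m₀.IsHomogeneous 1) (h₁ : m₁.IsHomogeneous 1)
    (hψ : ∀ j, ψ j 0 = C (u j) * m₀ + C (v j) * m₁)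
    (hφ : ∀ i, (∑ j, φ i j * C (u j)).IsHomogeneous 1) : False := by
  have hrel (i) : (∑ j, φ i j * C (u j)) * m₀ + (∑ j, φ i j * C (v j)) * m₁ = 0 := by
    rw [← h.sum_φ_mul_ψ_eq_zero i 0, Finset.sum_mul, Finset.sum_mul, ← Finset.sum_add_distrib]
    refine Finset.sum_congr rfl fun j _ => ?_
    rw [hψ]
    ring
  have hψ0 : ¬ ∀ j, ψ j 0 = 0 := by
    intro h0
    have : (1 : Fin 1 → MvPolynomial σ k) = 0 := h.injective_ψ (by
      ext j : 1
      simp [Matrix.mulVec, dotProduct, h0])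
    exact one_ne_zero (congrFun this 0)
  by_cases hm₁ : m₁ = 0
  · have hm₀ : m₀ ≠ 0 := by
      rintro rfl
      exact hψ0 fun j => by simp [hψ, hm₁]
    refine hu (h.eq_zero_of_φ_mulVec_C fun i => ?_)
    have := hrel i
    rw [hm₁, mul_zero, add_zero] at this
    exact (mul_eq_zero.1 this).resolve_right hm₀
  by_cases hdvd : m₁ ∣ m₀
  · obtain ⟨γ, rfl⟩ := exists_eq_C_mul_of_dvd hdvd
      (h₀.totalDegree_le.trans (h₁.totalDegree hm₁).ge)
    refine huv γ (h.eq_zero_of_φ_mulVec_C fun i => ?_)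
    apply mul_right_cancel₀ hm₁
    rw [zero_mul, ← hrel i]
    simp only [Pi.add_apply, Pi.smul_apply, smul_eq_mul, C_add, C_mul, mul_add,
      Finset.sum_add_distrib, add_mul, Finset.sum_mul]
    congr 1
    exact Finset.sum_congr rfl fun j _ => by ring
  have hα (i) : ∃ α : k, ∑ j, φ i j * C (u j) = C α * m₁ := by
    refine exists_eq_C_mul_of_dvd ?_ ((hφ i).totalDegree_le.trans (h₁.totalDegree hm₁).ge)
    refine ((h₁.prime_of_one hm₁).dvd_or_dvd (b := m₀) ?_).resolve_right hdvd
    exact ⟨-∑ j, φ i j * C (v j), by linear_combination hrel i⟩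
  choose α hα using hα
  have hα0 : α = 0 := by
    apply h.eq_zero_of_sum_C_mul_f
    apply mul_right_cancel₀ hm₁
    have h2 : ∑ i, f i * ∑ j, φ i j * C (u j) = 0 := by
      simp only [Finset.mul_sum, ← mul_assoc]
      rw [Finset.sum_comm]
      simp only [← Finset.sum_mul, h.sum_mul_φ_eq_zero, zero_mul, Finset.sum_const_zero]
    rw [zero_mul, ← h2, Finset.sum_mul]
    exact Finset.sum_congr rfl fun i _ => by rw [hα]; ring
  exact hu (h.eq_zero_of_φ_mulVec_C fun i => by rw [hα, hα0]; simp)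

end IsMinimalGradedResolution

end Resolution

/-! ### Linear independence of the entries of `ψ` -/

section LinearEntries

variable {k : Type*} [Field k]

/-- The graded resolution with Betti numbers `4, 4, 1`, in which `f` consists of four forms of
degree `d`, and `φ` of three columns of linear forms and one column of forms of degree `d - 1`. -/
abbrev IsFourGeneratorResolution (d : ℕ) (J : Ideal (MvPolynomial (Fin 4) k))
    (f : Fin 4 → MvPolynomial (Fin 4) k) (φ : Matrix (Fin 4) (Fin 4) (MvPolynomial (Fin 4) k))
    (ψ : Matrix (Fin 4) (Fin 1) (MvPolynomial (Fin 4) k)) : Prop :=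
  IsMinimalGradedResolution J (fun _ => (d : ℤ))
    ![(d : ℤ) + 1, (d : ℤ) + 1, (d : ℤ) + 1, 2 * (d : ℤ) - 1] (fun _ => (d : ℤ) + 2) f φ ψ

variable {d : ℕ} {J : Ideal (MvPolynomial (Fin 4) k)} {f : Fin 4 → MvPolynomial (Fin 4) k}
  {φ : Matrix (Fin 4) (Fin 4) (MvPolynomial (Fin 4) k)}
  {ψ : Matrix (Fin 4) (Fin 1) (MvPolynomial (Fin 4) k)}

namespace IsFourGeneratorResolution

lemma isHomogeneous_φ_castSucc (h : IsFourGeneratorResolution d J f φ ψ)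
    (i : Fin 4) (j : Fin 3) : (φ i j.castSucc).IsHomogeneous 1 := by
  refine isHomogeneous_of_support_degree (h.graded_φ i j.castSucc) ?_
  fin_cases j <;> simp

lemma isHomogeneous_ψ_castSucc (h : IsFourGeneratorResolution d J f φ ψ)
    (j : Fin 3) : (ψ j.castSucc 0).IsHomogeneous 1 := by
  refine isHomogeneous_of_support_degree (h.graded_ψ j.castSucc 0) ?_
  fin_cases j <;> simp

/-- If the last entry of `ψ` vanishes, the other three are linearly independent over `k`:
by a relation they would all be combinations of two of them. -/
lemma linearIndependent_ψ (h : IsFourGeneratorResolution d J f φ ψ)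
    (h3 : ψ 3 0 = 0) (c : Fin 3 → k) (hc : ∑ i, C (c i) * ψ i.castSucc 0 = 0) : c = 0 := by
  by_contra hne
  have hφ0 (i) : (φ i 0).IsHomogeneous 1 := h.isHomogeneous_φ_castSucc i 0
  have hφ1 (i) : (φ i 1).IsHomogeneous 1 := h.isHomogeneous_φ_castSucc i 1
  have hφ2 (i) : (φ i 2).IsHomogeneous 1 := h.isHomogeneous_φ_castSucc i 2
  have hψ0 : (ψ 0 0).IsHomogeneous 1 := h.isHomogeneous_ψ_castSucc 0
  have hψ1 : (ψ 1 0).IsHomogeneous 1 := h.isHomogeneous_ψ_castSucc 1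
  have hψ2 : (ψ 2 0).IsHomogeneous 1 := h.isHomogeneous_ψ_castSucc 2
  have hdiv {x y z : MvPolynomial (Fin 4) k} {a b e : k} (ha : a ≠ 0)
      (hxyz : C a * x + C b * y + C e * z = 0) : x = C (-(b / a)) * y + C (-(e / a)) * z := by
    have hb : (C a : MvPolynomial (Fin 4) k) * C (b / a) = C b := by
      rw [← C_mul, mul_div_cancel₀ _ ha]
    have he : (C a : MvPolynomial (Fin 4) k) * C (e / a) = C e := by
      rw [← C_mul, mul_div_cancel₀ _ ha]
    apply mul_left_cancel₀ (show (C a : MvPolynomial (Fin 4) k) ≠ 0 by simpa using ha)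
    rw [C_neg, C_neg]
    linear_combination hxyz + y * hb + z * he
  have hlin {p q : MvPolynomial (Fin 4) k} (a b : k) (hp : p.IsHomogeneous 1)
      (hq : q.IsHomogeneous 1) : (p * C a + q * C b).IsHomogeneous 1 := by
    rw [mul_comm p, mul_comm q]
    exact (hp.C_mul _).add (hq.C_mul _)
  simp only [Fin.sum_univ_three, Fin.castSucc_zero, Fin.castSucc_one,
    show (2 : Fin 3).castSucc = 2 from rfl] at hc
  obtain ⟨i, hi⟩ := Function.ne_iff.1 hne
  obtain rfl | rfl | rfl : i = 0 ∨ i = 1 ∨ i = 2 := by fin_cases i <;> simp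
  · have hdep := hdiv (x := ψ 0 0) (y := ψ 1 0) (z := ψ 2 0) (b := c 1) (e := c 2) hi hc
    refine IsMinimalGradedResolution.false_of_ψ_eq_two_linearForms h (u := ![-(c 1 / c 0), 1, 0, 0])
      (v := ![-(c 2 / c 0), 0, 1, 0])
      (fun hu => by simpa using congrFun hu 1) (fun γ hu => ?_) hψ1 hψ2 (fun j => ?_)
      (fun i => ?_)
    · have := congrFun hu 2
      simp at this
    · match j with
      | 0 => rw [hdep]; rfl
      | 1 => simp
      | 2 => simp
      | 3 => simp [h3]
    · rw [Fin.sum_univ_four]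
      simpa using hlin (-(c 1 / c 0)) 1 (hφ0 i) (hφ1 i)
  · have hdep := hdiv (x := ψ 1 0) (y := ψ 0 0) (z := ψ 2 0) (b := c 0) (e := c 2) hi
      (by linear_combination hc)
    refine IsMinimalGradedResolution.false_of_ψ_eq_two_linearForms h (u := ![1, -(c 0 / c 1), 0, 0])
      (v := ![0, -(c 2 / c 1), 1, 0])
      (fun hu => by simpa using congrFun hu 0) (fun γ hu => ?_) hψ0 hψ2 (fun j => ?_)
      (fun i => ?_)
    · have := congrFun hu 2
      simp at this
    · match j with
      | 0 => simp
      | 1 => rw [hdep]; rfl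
      | 2 => simp
      | 3 => simp [h3]
    · rw [Fin.sum_univ_four]
      simpa using hlin 1 (-(c 0 / c 1)) (hφ0 i) (hφ1 i)
  · have hdep := hdiv (x := ψ 2 0) (y := ψ 0 0) (z := ψ 1 0) (b := c 0) (e := c 1) hi
      (by linear_combination hc)
    refine IsMinimalGradedResolution.false_of_ψ_eq_two_linearForms h (u := ![1, 0, -(c 0 / c 2), 0])
      (v := ![0, 1, -(c 1 / c 2), 0])
      (fun hu => by simpa using congrFun hu 0) (fun γ hu => ?_) hψ0 hψ1 (fun j => ?_)
      (fun i => ?_)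
    · have := congrFun hu 1
      simp at this
    · match j with
      | 0 => simp
      | 1 => simp
      | 2 => rw [hdep]; rfl
      | 3 => simp [h3]
    · rw [Fin.sum_univ_four]
      simpa using hlin 1 (-(c 0 / c 2)) (hφ0 i) (hφ2 i)

end IsFourGeneratorResolution

end LinearEntries

/-! ### The normal form of the resolution -/

section NormalForm

variable {k : Type*} [Field k]

lemma scalarMatrix_mul (A B : Matrix.GeneralLinearGroup (Fin 4) k) :
    scalarMatrix (A * B) = scalarMatrix A * scalarMatrix B := by
  simp [scalarMatrix, Matrix.map_mul]

lemma scalarMatrix_one : scalarMatrix (1 : Matrix.GeneralLinearGroup (Fin 4) k) = 1 := by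
  exact Matrix.map_one C C_0 C_1

lemma scalarMatrix_mul_inv (A : Matrix.GeneralLinearGroup (Fin 4) k) :
    scalarMatrix A * scalarMatrix A⁻¹ = 1 := by
  rw [← scalarMatrix_mul, mul_inv_cancel, scalarMatrix_one]

lemma scalarMatrix_inv_mul (A : Matrix.GeneralLinearGroup (Fin 4) k) :
    scalarMatrix A⁻¹ * scalarMatrix A = 1 := by
  rw [← scalarMatrix_mul, inv_mul_cancel, scalarMatrix_one]

/-- A matrix of scalars is unchanged by an automorphism over `k`. -/
lemma scalarMatrix_map (A : Matrix.GeneralLinearGroup (Fin 4) k)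
    (τ : MvPolynomial (Fin 4) k ≃ₐ[k] MvPolynomial (Fin 4) k) :
    (scalarMatrix A).map τ = scalarMatrix A := by
  ext i j
  simp only [scalarMatrix, Matrix.map_apply]
  rw [show (C (A i j) : MvPolynomial (Fin 4) k) = algebraMap k _ (A i j) from rfl, τ.commutes]

lemma span_range_vecMul_le {ι κ R : Type*} [CommRing R] [Fintype ι] (v : ι → R)
    (M : Matrix ι κ R) : Ideal.span (Set.range (Matrix.vecMul v M)) ≤ Ideal.span (Set.range v) := by
  rw [Ideal.span_le]
  rintro _ ⟨j, rfl⟩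
  exact Ideal.sum_mem _ fun i _ => Ideal.mul_mem_right _ _ (Ideal.subset_span ⟨i, rfl⟩)

/-- Generators that differ by an invertible matrix of scalars generate the same ideal. -/
lemma span_range_vecMul_scalarMatrix (v : Fin 4 → MvPolynomial (Fin 4) k)
    (A : Matrix.GeneralLinearGroup (Fin 4) k) :
    Ideal.span (Set.range (Matrix.vecMul v (scalarMatrix A))) = Ideal.span (Set.range v) := by
  refine le_antisymm (span_range_vecMul_le _ _) ?_
  conv_lhs => rw [← Matrix.vecMul_one v, ← scalarMatrix_mul_inv A, ← Matrix.vecMul_vecMul]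
  exact span_range_vecMul_le _ _

/-- The matrix of `koszulNormalForm`, with `X 0, X 1, X 2` replaced by arbitrary elements. -/
noncomputable def koszulBlock (l₀ l₁ l₂ q₀ q₁ q₂ q : MvPolynomial (Fin 4) k) :
    Matrix (Fin 4) (Fin 4) (MvPolynomial (Fin 4) k) :=
  !![0, l₂, -l₁, -q₀;
     -l₂, 0, l₀, -q₁;
     l₁, -l₀, 0, -q₂;
     0, 0, 0, q]

namespace IsFourGeneratorResolution

variable {d : ℕ} {J : Ideal (MvPolynomial (Fin 4) k)} {f : Fin 4 → MvPolynomial (Fin 4) k}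
  {φ : Matrix (Fin 4) (Fin 4) (MvPolynomial (Fin 4) k)}
  {ψ : Matrix (Fin 4) (Fin 1) (MvPolynomial (Fin 4) k)}

/-- The rows of the first three columns of `φ` are linear syzygies of the linear forms `ψ₀, ψ₁, ψ₂`.
Hence these columns are `c` times the Koszul matrix, for a matrix `c` of scalars. Since `f φ = 0`,
the vector `f c` is annihilated by the Koszul matrix, that is, a multiple of `(ψ₀, ψ₁, ψ₂)`. -/
lemma exists_koszul_columns (h : IsFourGeneratorResolution d J f φ ψ) (h3 : ψ 3 0 = 0)
    {τ : MvPolynomial (Fin 4) k ≃ₐ[k] MvPolynomial (Fin 4) k} (hτ : IsLinearChange τ)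
    (hτψ : ∀ j : Fin 3, τ (ψ j.castSucc 0) = X j.castSucc) :
    ∃ (c : Fin 4 → Fin 3 → k) (g : MvPolynomial (Fin 4) k),
      (∀ i, φ i 0 = C (c i 2) * ψ 1 0 - C (c i 1) * ψ 2 0 ∧
        φ i 1 = C (c i 0) * ψ 2 0 - C (c i 2) * ψ 0 0 ∧
        φ i 2 = C (c i 1) * ψ 0 0 - C (c i 0) * ψ 1 0) ∧
      (∀ j : Fin 3, ∑ i, f i * C (c i j) = g * ψ j.castSucc 0) ∧ g ≠ 0 ∧
      LinearIndependent k fun j i => c i j := by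
  have hτ0 : τ (ψ 0 0) = X 0 := hτψ 0
  have hτ1 : τ (ψ 1 0) = X 1 := hτψ 1
  have hτ2 : τ (ψ 2 0) = X 2 := hτψ 2
  have hτC (c : k) : τ (C c) = C c := τ.commutes c
  have hne (j : Fin 3) : ψ j.castSucc 0 ≠ 0 := fun h0 => by
    have := hτψ j
    rw [h0, map_zero] at this
    exact X_ne_zero _ this.symm
  have hrow (i) : ∃ c : Fin 3 → k, φ i 0 = C (c 2) * ψ 1 0 - C (c 1) * ψ 2 0 ∧
        φ i 1 = C (c 0) * ψ 2 0 - C (c 2) * ψ 0 0 ∧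
        φ i 2 = C (c 1) * ψ 0 0 - C (c 0) * ψ 1 0 := by
    have hrel := congrArg τ (IsMinimalGradedResolution.sum_φ_mul_ψ_eq_zero h i 0)
    simp only [Fin.sum_univ_four, h3, mul_zero, add_zero, map_add, map_mul, hτ0, hτ1, hτ2,
      map_zero] at hrel
    obtain ⟨c₀, c₁, c₂, e₀, e₁, e₂⟩ := exists_eq_koszul_of_linear_syzygy_X
      (hτ.isHomogeneous (h.isHomogeneous_φ_castSucc i 0))
      (hτ.isHomogeneous (h.isHomogeneous_φ_castSucc i 1))
      (hτ.isHomogeneous (h.isHomogeneous_φ_castSucc i 2)) hrel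
    refine ⟨![c₀, c₁, c₂], τ.injective ?_, τ.injective ?_, τ.injective ?_⟩
    · simpa [hτC, hτ1, hτ2] using e₀
    · simpa [hτC, hτ0, hτ2] using e₁
    · simpa [hτC, hτ0, hτ1] using e₂
  choose c hc using hrow
  -- the combinations of the generators with coefficients in the columns of `c` are annihilated by
  -- the Koszul matrix
  set G : Fin 3 → MvPolynomial (Fin 4) k := fun j => ∑ i, f i * C (c i j) with hG
  have hG0 : G 2 * ψ 1 0 = G 1 * ψ 2 0 := by
    rw [← sub_eq_zero, ← IsMinimalGradedResolution.sum_mul_φ_eq_zero h 0, hG, Finset.sum_mul,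
      Finset.sum_mul, ← Finset.sum_sub_distrib]
    exact Finset.sum_congr rfl fun i _ => by rw [(hc i).1]; ring
  have hG1 : G 0 * ψ 2 0 = G 2 * ψ 0 0 := by
    rw [← sub_eq_zero, ← IsMinimalGradedResolution.sum_mul_φ_eq_zero h 1, hG, Finset.sum_mul,
      Finset.sum_mul, ← Finset.sum_sub_distrib]
    exact Finset.sum_congr rfl fun i _ => by rw [(hc i).2.1]; ring
  have hG2 : G 1 * ψ 0 0 = G 0 * ψ 1 0 := by
    rw [← sub_eq_zero, ← IsMinimalGradedResolution.sum_mul_φ_eq_zero h 2, hG, Finset.sum_mul,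
      Finset.sum_mul, ← Finset.sum_sub_distrib]
    exact Finset.sum_congr rfl fun i _ => by rw [(hc i).2.2]; ring
  have hreg : IsRegularTriple (MvPolynomial (Fin 4) k) (τ (ψ 0 0)) (τ (ψ 1 0)) (τ (ψ 2 0)) := by
    rw [hτ0, hτ1, hτ2]
    exact isRegularTriple_X (by decide) (by decide) (by decide)
  obtain ⟨g', hg'⟩ := hreg.snd (τ (G 0)) (τ (G 1)) (by
    rw [smul_eq_mul, smul_eq_mul, ← map_mul, ← map_mul, mul_comm _ (G 1), hG2, mul_comm])
  set g := τ.symm g' with hg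
  have e0 : G 0 = g * ψ 0 0 := τ.injective (by rw [hg', map_mul, hg]; simp [mul_comm])
  have e1 : G 1 = g * ψ 1 0 := by
    apply mul_right_cancel₀ (hne 0)
    rw [Fin.castSucc_zero, hG2, e0]
    ring
  have e2 : G 2 = g * ψ 2 0 := by
    apply mul_right_cancel₀ (hne 0)
    rw [Fin.castSucc_zero, ← hG1, e0]
    ring
  have hGg : ∀ j : Fin 3, G j = g * ψ j.castSucc 0 := by
    intro j
    match j with
    | 0 => exact e0
    | 1 => exact e1
    | 2 => exact e2
  have hg0 : g ≠ 0 := by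
    intro hg0
    have hc0 (j : Fin 3) : (fun i => c i j) = 0 := by
      apply IsMinimalGradedResolution.eq_zero_of_sum_C_mul_f h
      rw [← zero_mul (ψ j.castSucc 0), ← hg0, ← hGg j]
      exact Finset.sum_congr rfl fun i _ => mul_comm _ _
    have : (Pi.single 0 1 : Fin 4 → k) = 0 := by
      apply IsMinimalGradedResolution.eq_zero_of_φ_mulVec_C h
      intro i
      rw [Fin.sum_univ_four]
      simp [(hc i).1, congrFun (hc0 2) i, congrFun (hc0 1) i]
    simpa using congrFun this 0
  refine ⟨c, g, hc, hGg, hg0, ?_⟩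
  rw [Fintype.linearIndependent_iff]
  intro y hy
  refine congrFun (h.linearIndependent_ψ h3 y ?_)
  apply mul_left_cancel₀ hg0
  have hy' (i) : ∑ j, y j * c i j = 0 := by simpa using congrFun hy i
  rw [mul_zero, Finset.mul_sum]
  calc ∑ j, g * (C (y j) * ψ j.castSucc 0) = ∑ j, C (y j) * G j :=
        Finset.sum_congr rfl fun j _ => by rw [hGg]; ring
    _ = ∑ i, f i * C (∑ j, y j * c i j) := by
        simp only [hG, Finset.mul_sum, map_sum, C_mul]
        rw [Finset.sum_comm]
        exact Finset.sum_congr rfl fun i _ => Finset.sum_congr rfl fun j _ => by ring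
    _ = 0 := by simp [hy']

/-- Completing the columns of `exists_koszul_columns` to an invertible matrix gives row operations
that bring `φ` into block form. -/
lemma exists_scalarMatrix_mul_eq_koszulBlock (h : IsFourGeneratorResolution d J f φ ψ) (hd : 2 ≤ d)
    (h3 : ψ 3 0 = 0)
    {τ : MvPolynomial (Fin 4) k ≃ₐ[k] MvPolynomial (Fin 4) k} (hτ : IsLinearChange τ)
    (hτψ : ∀ j : Fin 3, τ (ψ j.castSucc 0) = X j.castSucc) :
    ∃ (A : Matrix.GeneralLinearGroup (Fin 4) k) (q₀ q₁ q₂ q g g₃ : MvPolynomial (Fin 4) k),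
      q₀.IsHomogeneous (d - 1) ∧ q₁.IsHomogeneous (d - 1) ∧ q₂.IsHomogeneous (d - 1) ∧
      q.IsHomogeneous (d - 1) ∧ g ≠ 0 ∧
      scalarMatrix A * φ = koszulBlock (ψ 0 0) (ψ 1 0) (ψ 2 0) q₀ q₁ q₂ q ∧
      f = Matrix.vecMul ![g * ψ 0 0, g * ψ 1 0, g * ψ 2 0, g₃] (scalarMatrix A) := by
  obtain ⟨c, g, hφ, hfc, hg, hind⟩ := h.exists_koszul_columns h3 hτ hτψ
  obtain ⟨M, hM, hMc⟩ := exists_isUnit_rows_eq hind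
  -- the columns of `P` are those of `c` and one more
  obtain ⟨P, hP⟩ : IsUnit M.transpose := by
    rwa [Matrix.isUnit_iff_isUnit_det, Matrix.det_transpose, ← Matrix.isUnit_iff_isUnit_det]
  have hPc (i : Fin 4) (j : Fin 3) : (scalarMatrix P) i j.castSucc = C (c i j) := by
    rw [scalarMatrix, Matrix.map_apply, hP, Matrix.transpose_apply, hMc]
  have hP0 (i : Fin 4) : (scalarMatrix P) i 0 = C (c i 0) := hPc i 0
  have hP1 (i : Fin 4) : (scalarMatrix P) i 1 = C (c i 1) := hPc i 1
  have hP2 (i : Fin 4) : (scalarMatrix P) i 2 = C (c i 2) := hPc i 2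
  set A := P⁻¹ with hA
  set T := scalarMatrix A * φ with hT
  have hPT : scalarMatrix P * T = φ := by
    rw [hT, ← Matrix.mul_assoc, hA, scalarMatrix_mul_inv, Matrix.one_mul]
  have hT3 (i : Fin 4) : (T i 3).IsHomogeneous (d - 1) := by
    rw [hT, Matrix.mul_apply]
    refine IsHomogeneous.sum _ _ _ fun j _ => IsHomogeneous.C_mul ?_ _
    refine isHomogeneous_of_support_degree (h.graded_φ j 3) ?_
    simp
    omega
  have hTK : scalarMatrix A * φ =
      koszulBlock (ψ 0 0) (ψ 1 0) (ψ 2 0) (-T 0 3) (-T 1 3) (-T 2 3) (T 3 3) := by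
    have key : scalarMatrix P *
        koszulBlock (ψ 0 0) (ψ 1 0) (ψ 2 0) (-T 0 3) (-T 1 3) (-T 2 3) (T 3 3) = φ := by
      ext i j : 1
      rw [Matrix.mul_apply, Fin.sum_univ_four, hP0, hP1, hP2]
      match j with
      | 0 => simp [koszulBlock, (hφ i).1]; ring
      | 1 => simp [koszulBlock, (hφ i).2.1]; ring
      | 2 => simp [koszulBlock, (hφ i).2.2]; ring
      | 3 =>
        rw [← hPT, Matrix.mul_apply, Fin.sum_univ_four, hP0, hP1, hP2]
        simp [koszulBlock]
    conv_lhs => rw [← key]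
    rw [← Matrix.mul_assoc, hA, scalarMatrix_inv_mul, Matrix.one_mul]
  refine ⟨A, -T 0 3, -T 1 3, -T 2 3, T 3 3, g, Matrix.vecMul f (scalarMatrix P) 3, (hT3 0).neg,
    (hT3 1).neg, (hT3 2).neg, hT3 3, hg, hTK, ?_⟩
  have hv : ![g * ψ 0 0, g * ψ 1 0, g * ψ 2 0, Matrix.vecMul f (scalarMatrix P) 3] =
      Matrix.vecMul f (scalarMatrix P) := by
    funext j
    match j with
    | 0 => simpa [Matrix.vecMul, dotProduct, hP0] using (hfc 0).symm
    | 1 => simpa [Matrix.vecMul, dotProduct, hP1] using (hfc 1).symm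
    | 2 => simpa [Matrix.vecMul, dotProduct, hP2] using (hfc 2).symm
    | 3 => rfl
  rw [hv, Matrix.vecMul_vecMul, hA, scalarMatrix_mul_inv, Matrix.vecMul_one]

/-- The normal form of the resolution in the original coordinates, where the linear forms `ψ₀, ψ₁,
ψ₂` take the place of `X 0, X 1, X 2`. The last column of `φ` gives the relation `g h = g₃ q` with
`h = q₀ψ₀ + q₁ψ₁ + q₂ψ₂`. As `J` has codimension two, `g` and `g₃` are coprime, and comparing
degrees shows that `q` and `g` differ by a scalar. -/
theorem exists_normalForm (h : IsFourGeneratorResolution d J f φ ψ) (hd : 2 ≤ d)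
    (hJ : J.height = 2) (h3 : ψ 3 0 = 0)
    {τ : MvPolynomial (Fin 4) k ≃ₐ[k] MvPolynomial (Fin 4) k} (hτ : IsLinearChange τ)
    (hτψ : ∀ j : Fin 3, τ (ψ j.castSucc 0) = X j.castSucc) :
    ∃ (A : Matrix.GeneralLinearGroup (Fin 4) k) (q₀ q₁ q₂ q : MvPolynomial (Fin 4) k),
      q₀.IsHomogeneous (d - 1) ∧ q₁.IsHomogeneous (d - 1) ∧ q₂.IsHomogeneous (d - 1) ∧
      q.IsHomogeneous (d - 1) ∧ q ≠ 0 ∧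
      (∀ x, q ∣ (q₀ * ψ 0 0 + q₁ * ψ 1 0 + q₂ * ψ 2 0) * x → q ∣ x) ∧
      scalarMatrix A * φ = koszulBlock (ψ 0 0) (ψ 1 0) (ψ 2 0) q₀ q₁ q₂ q ∧
      f = Matrix.vecMul ![q * ψ 0 0, q * ψ 1 0, q * ψ 2 0,
        q₀ * ψ 0 0 + q₁ * ψ 1 0 + q₂ * ψ 2 0] (scalarMatrix A) := by
  obtain ⟨A, q₀, q₁, q₂, q, g, g₃, hq₀, hq₁, hq₂, hq, hg, hA, hf⟩ :=
    h.exists_scalarMatrix_mul_eq_koszulBlock hd h3 hτ hτψ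
  have hψ0 : ψ 0 0 ≠ 0 := fun h0 => by
    have := hτψ 0
    rw [Fin.castSucc_zero, h0, map_zero] at this
    exact X_ne_zero _ this.symm
  have hgv : Matrix.vecMul f (scalarMatrix A⁻¹) = ![g * ψ 0 0, g * ψ 1 0, g * ψ 2 0, g₃] := by
    rw [hf, Matrix.vecMul_vecMul, scalarMatrix_mul_inv, Matrix.vecMul_one]
  -- the relation given by the last column of `φ`
  have hrel : g * (q₀ * ψ 0 0 + q₁ * ψ 1 0 + q₂ * ψ 2 0) = g₃ * q := by
    have hfφ : Matrix.vecMul f φ = 0 :=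
      funext fun j => IsMinimalGradedResolution.sum_mul_φ_eq_zero h j
    rw [hf, Matrix.vecMul_vecMul, hA] at hfφ
    have := congrFun hfφ 3
    simp [Matrix.vecMul, dotProduct, Fin.sum_univ_four, koszulBlock] at this
    linear_combination -this
  have hcop : IsRelPrime g g₃ := by
    intro p hpg hp3
    by_contra hp
    have hle : J ≤ Ideal.span {p} := by
      rw [← h.span_f, hf, span_range_vecMul_scalarMatrix, Ideal.span_le]
      rintro _ ⟨j, rfl⟩
      rw [SetLike.mem_coe, Ideal.mem_span_singleton]
      match j with
      | 0 => exact hpg.mul_right _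
      | 1 => exact hpg.mul_right _
      | 2 => exact hpg.mul_right _
      | 3 => exact hp3
    have := (Ideal.height_mono hle).trans (Ideal.height_span_singleton_le_one hp)
    rw [hJ] at this
    exact absurd this (by decide)
  -- if `q` were zero, the syzygy `(g₃, 0, 0, -g ψ₀)` would not be in the image of `φ`
  have hq0 : q ≠ 0 := by
    intro hq0
    set w : Fin 4 → MvPolynomial (Fin 4) k := ![g₃, 0, 0, -(g * ψ 0 0)] with hw
    obtain ⟨z, hz⟩ := IsMinimalGradedResolution.exists_eq_φ_mulVec h
      (v := (scalarMatrix A⁻¹).mulVec w) (by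
        have : (scalarMatrix A⁻¹).mulVec w ⬝ᵥ f = 0 := by
          rw [dotProduct_comm, Matrix.dotProduct_mulVec, hgv, hw]
          simp [dotProduct, Fin.sum_univ_four]
          ring
        exact this)
    have hz' := congrArg (Matrix.mulVec (scalarMatrix A)) hz
    rw [Matrix.mulVec_mulVec, Matrix.mulVec_mulVec, scalarMatrix_mul_inv, Matrix.one_mulVec,
      hA] at hz'
    have := congrFun hz' 3
    simp [koszulBlock, hq0, hw, Matrix.mulVec, dotProduct, Fin.sum_univ_four, hg, hψ0] at this
  have hdvd : g ∣ q := hcop.dvd_of_dvd_mul_left (y := g₃) ⟨_, hrel.symm⟩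
  have hgdeg : q.totalDegree ≤ g.totalDegree := by
    have h0 : (g * ψ 0 0).IsHomogeneous d := by
      have hfirst : Matrix.vecMul f (scalarMatrix A⁻¹) 0 = g * ψ 0 0 := congrFun hgv 0
      rw [← hfirst, Matrix.vecMul, dotProduct]
      refine IsHomogeneous.sum _ _ _ fun j _ => ?_
      rw [mul_comm]
      exact (isHomogeneous_of_support_degree (h.graded_f j) rfl).C_mul _
    have h1 := totalDegree_mul_of_isDomain hg hψ0
    have h2 : (ψ 0 0).totalDegree = 1 := (h.isHomogeneous_ψ_castSucc 0).totalDegree hψ0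
    rw [h0.totalDegree (mul_ne_zero hg hψ0), h2] at h1
    rw [hq.totalDegree hq0]
    omega
  obtain ⟨c, rfl⟩ := exists_eq_C_mul_of_dvd hdvd hgdeg
  have hc : c ≠ 0 := by
    rintro rfl
    simp at hq0
  have hC : (C c⁻¹ : MvPolynomial (Fin 4) k) * C c = 1 := by
    rw [← C_mul, inv_mul_cancel₀ hc, C_1]
  have hh : q₀ * ψ 0 0 + q₁ * ψ 1 0 + q₂ * ψ 2 0 = C c * g₃ := by
    apply mul_left_cancel₀ hg
    linear_combination hrel
  -- rescale the last basis vector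
  let D : Matrix.GeneralLinearGroup (Fin 4) k :=
    ⟨Matrix.diagonal ![1, 1, 1, c⁻¹], Matrix.diagonal ![1, 1, 1, c], by
      rw [Matrix.diagonal_mul_diagonal, ← Matrix.diagonal_one]
      congr 1
      funext i
      fin_cases i <;> simp [hc], by
      rw [Matrix.diagonal_mul_diagonal, ← Matrix.diagonal_one]
      congr 1
      funext i
      fin_cases i <;> simp [hc]⟩
  have hD : scalarMatrix D = Matrix.diagonal ![1, 1, 1, C c⁻¹] := by
    have : scalarMatrix D = (Matrix.diagonal ![1, 1, 1, c⁻¹]).map C := rfl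
    rw [this, Matrix.diagonal_map (map_zero _)]
    congr 1
    funext i
    match i with
    | 0 | 1 | 2 => simp
    | 3 => rfl
  have hg' : g.IsHomogeneous (d - 1) := by
    have := hq.C_mul c⁻¹
    rwa [← mul_assoc, hC, one_mul] at this
  refine ⟨D * A, q₀, q₁, q₂, g, hq₀, hq₁, hq₂, hg', hg, fun x hx => ?_, ?_, ?_⟩
  · rw [hh] at hx
    obtain ⟨y, hy⟩ := hx
    refine hcop.dvd_of_dvd_mul_left ⟨C c⁻¹ * y, ?_⟩
    linear_combination C c⁻¹ * hy - g₃ * x * hC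
  · rw [scalarMatrix_mul, Matrix.mul_assoc, hA, hD]
    ext i j : 1
    rw [Matrix.diagonal_mul]
    match i with
    | 0 | 1 | 2 => simp [koszulBlock]
    | 3 =>
      match j with
      | 0 | 1 | 2 => simp [koszulBlock]
      | 3 =>
        change C c⁻¹ * (C c * g) = g
        rw [← mul_assoc, hC, one_mul]
  · rw [scalarMatrix_mul, ← Matrix.vecMul_vecMul, hD]
    conv_lhs => rw [hf]
    congr 1
    funext j
    rw [Matrix.vecMul_diagonal, hh]
    match j with
    | 0 | 1 | 2 => simp
    | 3 =>
      change g₃ = C c * g₃ * C c⁻¹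
      linear_combination -g₃ * hC

end IsFourGeneratorResolution

end NormalForm

/-! ### The last entry of `ψ` -/

section Unmixed

variable {k : Type*} [Field k]

lemma mem_range_linearCombination_iff {R ι : Type*} [CommRing R] [Fintype ι] {f : ι → R} {x : R} :
    x ∈ LinearMap.range (Fintype.linearCombination R f) ↔ x ∈ Ideal.span (Set.range f) := by
  rw [Fintype.range_linearCombination]

namespace IsFourGeneratorResolution

variable {d : ℕ} {J : Ideal (MvPolynomial (Fin 4) k)} {f : Fin 4 → MvPolynomial (Fin 4) k}
  {φ : Matrix (Fin 4) (Fin 4) (MvPolynomial (Fin 4) k)}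
  {ψ : Matrix (Fin 4) (Fin 1) (MvPolynomial (Fin 4) k)}

/-- If the entries of `ψ` are four independent linear forms, then `J` is unmixed. An associated
prime `P` of height at least three contains a regular sequence of length three, and the depth
argument shows that `P` contains the entries of `ψ`. Applied to the regular sequence formed by
three of these entries, the same argument shows that `P` contains `1`. -/
theorem isUnmixed (h : IsFourGeneratorResolution d J f φ ψ) (hJ : J.height = 2)
    (hl : ∀ j, (ψ j 0).IsHomogeneous 1)
    (hind : ∀ c : Fin 4 → k, ∑ i, C (c i) * ψ i 0 = 0 → c = 0) : IsUnmixed J := by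
  obtain ⟨τ, -, -, hτ⟩ := exists_isLinearChange_four hl hind
  have hreg : IsRegularTriple (MvPolynomial (Fin 4) k) (ψ 0 0) (ψ 1 0) (ψ 2 0) := by
    have := (isRegularTriple_X (k := k) (σ := Fin 4) (i := 0) (j := 1) (m := 2) (by decide)
      (by decide) (by decide)).map τ.symm.toRingEquiv
    simpa [← hτ] using! this
  have hlast : ∀ s u v w, ψ 3 0 * s = ψ 0 0 * u + ψ 1 0 * v + ψ 2 0 * w →
      ∃ u' v' w', s = ψ 0 0 * u' + ψ 1 0 * v' + ψ 2 0 * w' := by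
    intro s u v w hs
    have hp := isPrime_span_X_image (k := k) ({0, 1, 2} : Set (Fin 4))
    have h3 : (X 3 : MvPolynomial (Fin 4) k) ∉ Ideal.span (X '' ({0, 1, 2} : Set (Fin 4))) := by
      rw [X_mem_span_X_image_iff]
      decide
    have hmem : τ s ∈ Ideal.span (X '' ({0, 1, 2} : Set (Fin 4))) := by
      refine (hp.mem_or_mem (x := X 3) ?_).resolve_left h3
      have := congrArg τ hs
      simp only [map_mul, map_add, hτ] at this
      rw [this]
      exact add_mem (add_mem (Ideal.mul_mem_right _ _ (Ideal.subset_span ⟨0, by simp, rfl⟩))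
        (Ideal.mul_mem_right _ _ (Ideal.subset_span ⟨1, by simp, rfl⟩)))
        (Ideal.mul_mem_right _ _ (Ideal.subset_span ⟨2, by simp, rfl⟩))
    simp only [Set.image_insert_eq, Set.image_singleton, Ideal.mem_span_insert,
      Ideal.mem_span_singleton'] at hmem
    obtain ⟨u', _, ⟨v', _, ⟨w', rfl⟩, rfl⟩, he⟩ := hmem
    refine ⟨τ.symm u', τ.symm v', τ.symm w', τ.injective ?_⟩
    simp only [map_add, map_mul, hτ, AlgEquiv.apply_symm_apply, he]
    ring
  have hmulVec (s : Fin 1 → MvPolynomial (Fin 4) k) (i) : ψ.mulVecLin s i = ψ i 0 * s 0 := by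
    simp [Matrix.mulVec, dotProduct]
  refine le_antisymm (fun z hz => ?_) (le_unmixedPart J)
  by_contra hzJ
  obtain ⟨P, hP, hzP⟩ := exists_mem_associatedPrimes_quotient hzJ
  obtain ⟨hPprime, w, hw⟩ := mem_associatedPrimes_quotient_iff.1 hP
  have hJP : J ≤ P := fun x hx => (hw x).2 (Ideal.mul_mem_right _ _ hx)
  have h3 : 3 ≤ P.height := by
    have h2 : 2 ≤ P.height := hJ ▸ Ideal.height_mono hJP
    rcases h2.lt_or_eq with hlt | heq
    · have := Order.add_one_le_of_lt hlt
      rwa [show (2 : ℕ∞) + 1 = 3 by norm_num] at this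
    · obtain ⟨s, hs, hsz⟩ := mem_unmixedPart_iff.1 hz P hPprime hJP (heq.symm.trans hJ.symm)
      exact absurd (hzP s hsz) hs
  obtain ⟨a, ha, b, hb, c, hc, habc⟩ := primesHaveGradeThree k 4 P hPprime h3
  have hmem : ∀ x, x ∈ LinearMap.range (Fintype.linearCombination (MvPolynomial (Fin 4) k) f) ↔
      x ∈ J := fun x => by rw [mem_range_linearCombination_iff, h.span_f]
  have hψP (i) : ψ i 0 ∈ P := by
    rw [hw, ← hmem]
    refine exists_eq_of_regularTriple_mul_mem h.exact_φ_f h.exact_ψ_φ habc (habc.pi _) (habc.pi _)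
      (fun s u v w hs => ⟨fun _ => u i, fun _ => v i, fun _ => w i, ?_⟩)
      ((hmem _).2 ((hw _).1 ha)) ((hmem _).2 ((hw _).1 hb)) ((hmem _).2 ((hw _).1 hc))
    funext j
    have := congrFun hs i
    rw [hmulVec] at this
    rw [Subsingleton.elim j 0]
    exact this
  refine hPprime.ne_top ((Ideal.eq_top_iff_one _).2 ((hw 1).2 ((hmem _).1 ?_)))
  refine exists_eq_of_regularTriple_mul_mem h.exact_φ_f h.exact_ψ_φ hreg (hreg.pi _) (hreg.pi _)
    (fun s u v w hs => ?_)
    ((hmem _).2 ((hw _).1 (hψP 0))) ((hmem _).2 ((hw _).1 (hψP 1)))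
    ((hmem _).2 ((hw _).1 (hψP 2)))
  have hs3 := congrFun hs 3
  rw [hmulVec] at hs3
  obtain ⟨u', v', w', he⟩ := hlast _ _ _ _ hs3
  refine ⟨fun _ => u', fun _ => v', fun _ => w', ?_⟩
  funext j
  rw [Subsingleton.elim j 0, one_smul]
  exact he

/-- Change of basis in the middle module, for `d = 2`, where all its generators have the same
degree. -/
lemma change_basis (h : IsFourGeneratorResolution 2 J f φ ψ)
    (B : Matrix.GeneralLinearGroup (Fin 4) k) :
    IsFourGeneratorResolution 2 J f (φ * scalarMatrix B⁻¹) (scalarMatrix B * ψ) := by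
  have hdeg (j : Fin 4) :
      (![((2 : ℕ) : ℤ) + 1, ((2 : ℕ) : ℤ) + 1, ((2 : ℕ) : ℤ) + 1, 2 * ((2 : ℕ) : ℤ) - 1] :
        Fin 4 → ℤ) j = 3 := by
    match j with
    | 0 | 1 | 2 | 3 => simp
  have hφ (i j) : (φ i j).IsHomogeneous 1 :=
    isHomogeneous_of_support_degree (h.graded_φ i j) (by rw [hdeg]; norm_num)
  have hψ (i j) : (ψ i j).IsHomogeneous 1 :=
    isHomogeneous_of_support_degree (h.graded_ψ i j) (by rw [hdeg]; norm_num)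
  have hsupp {p : MvPolynomial (Fin 4) k} (hp : p.IsHomogeneous 1) :
      ∀ m ∈ p.support, (m.degree : ℤ) = 1 := fun m hm => by
    rw [Finsupp.degree_eq_weight_one]
    exact_mod_cast hp (mem_support_iff.1 hm)
  refine ⟨h.graded_f, fun i j => ?_, fun i j => ?_, h.span_f, fun v => ?_, fun w => ?_,
    fun s t hst => ?_, fun i j => ?_, fun i j => ?_⟩
  · rw [hdeg]
    refine hsupp ?_
    rw [Matrix.mul_apply]
    refine IsHomogeneous.sum _ _ _ fun m _ => ?_
    rw [mul_comm]
    exact (hφ i m).C_mul _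
  · rw [hdeg]
    refine hsupp ?_
    rw [Matrix.mul_apply]
    exact IsHomogeneous.sum _ _ _ fun m _ => (hψ m j).C_mul _
  · rw [h.exact_φ_f v]
    constructor
    · rintro ⟨w, rfl⟩
      exact ⟨(scalarMatrix B).mulVec w, by
        simp [Matrix.mulVec_mulVec, scalarMatrix_inv_mul]⟩
    · rintro ⟨w, rfl⟩
      exact ⟨(scalarMatrix B⁻¹).mulVec w, by simp [Matrix.mulVec_mulVec]⟩
  · have := h.exact_ψ_φ ((scalarMatrix B⁻¹).mulVec w)
    simp only [Matrix.mulVecLin_apply, Matrix.mulVec_mulVec, Set.mem_range] at this ⊢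
    rw [this]
    refine exists_congr fun s => ⟨fun hs => ?_, fun hs => ?_⟩
    · rw [← Matrix.mulVec_mulVec, hs, Matrix.mulVec_mulVec, scalarMatrix_mul_inv,
        Matrix.one_mulVec]
    · rw [← hs, Matrix.mulVec_mulVec, ← Matrix.mul_assoc, scalarMatrix_inv_mul, Matrix.one_mul]
  · apply h.injective_ψ
    have := congrArg (Matrix.mulVec (scalarMatrix B⁻¹)) hst
    simpa [Matrix.mulVec_mulVec, ← Matrix.mul_assoc, scalarMatrix_inv_mul] using this
  · rw [Matrix.mul_apply]
    exact Ideal.sum_mem _ fun m _ => Ideal.mul_mem_right _ _ (h.minimal_φ i m)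
  · rw [Matrix.mul_apply]
    exact Ideal.sum_mem _ fun m _ => Ideal.mul_mem_left _ _ (h.minimal_ψ m j)

lemma two_le (h : IsFourGeneratorResolution d J f φ ψ) : 2 ≤ d := by
  by_contra hd
  -- the last column of `φ` vanishes for reasons of degree
  have hφ (i) : φ i 3 = 0 := by
    refine eq_zero_of_support_degree_le_zero (h.graded_φ i 3) ?_ (h.minimal_φ i 3)
    simp
    omega
  have : (Pi.single 3 1 : Fin 4 → k) = 0 := by
    apply IsMinimalGradedResolution.eq_zero_of_φ_mulVec_C h
    intro i
    rw [Fin.sum_univ_four]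
    simp [hφ i]
  simpa using congrFun this 3

/-- After a change of basis the last entry of `ψ` vanishes: for `d ≥ 3` it does so for reasons of
degree, and for `d = 2` because otherwise `J` would be unmixed. -/
lemma exists_last_entry_eq_zero (h : IsFourGeneratorResolution d J f φ ψ) (hJ : J.height = 2)
    (hunm : d = 2 → ¬ IsUnmixed J) :
    ∃ B : Matrix.GeneralLinearGroup (Fin 4) k, (3 ≤ d → B = 1) ∧
      IsFourGeneratorResolution d J f (φ * scalarMatrix B⁻¹) (scalarMatrix B * ψ) ∧
      (scalarMatrix B * ψ) 3 0 = 0 := by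
  rcases h.two_le.lt_or_eq with hd | rfl
  · refine ⟨1, fun _ => rfl, ?_, ?_⟩
    · rwa [inv_one, scalarMatrix_one, Matrix.mul_one, Matrix.one_mul]
    · rw [scalarMatrix_one, Matrix.one_mul]
      refine eq_zero_of_support_degree_le_zero (h.graded_ψ 3 0) ?_ (h.minimal_ψ 3 0)
      simp
      omega
  · have hl (j) : (ψ j 0).IsHomogeneous 1 := by
      refine isHomogeneous_of_support_degree (h.graded_ψ j 0) ?_
      match j with
      | 0 | 1 | 2 | 3 => simp
    have hdep : ∃ c : Fin 4 → k, ∑ i, C (c i) * ψ i 0 = 0 ∧ c ≠ 0 := by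
      by_contra! hind
      exact hunm rfl (h.isUnmixed hJ hl hind)
    obtain ⟨c, hc, hc0⟩ := hdep
    obtain ⟨_, ⟨B, rfl⟩, hB⟩ := exists_isUnit_last_row_eq hc0
    refine ⟨B, fun h3 => absurd h3 (by decide), h.change_basis B, ?_⟩
    rw [Matrix.mul_apply, ← hc]
    exact Finset.sum_congr rfl fun i _ => by rw [← hB]; rfl

end IsFourGeneratorResolution

end Unmixed

/-! ### The degree of a complete intersection -/

section HilbertFunction

variable {k : Type*} [Field k]

lemma finrank_homogeneousSubmodule_fin_four (t : ℕ) :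
    Module.finrank k (homogeneousSubmodule (Fin 4) k t) = (t + 3).choose 3 := by
  have h : homogeneousSubmodule (Fin 4) k t = restrictSupport k {m | m.degree = t} :=
    homogeneousSubmodule_eq_finsupp_supported _ _ t
  rw [h, Module.finrank_eq_nat_card_basis (basisRestrictSupport k {m | m.degree = t})]
  have hset : {m : Fin 4 →₀ ℕ | m.degree = t} =
      (Finset.univ.finsuppAntidiag t : Finset (Fin 4 →₀ ℕ)) := by
    ext m
    simp [Finset.mem_finsuppAntidiag, Finsupp.degree_eq_sum]
  rw [hset, Nat.card_coe_set_eq, Set.ncard_coe_finset, Finset.card_finsuppAntidiag_nat_eq_choose]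
  simp only [Finset.card_univ, Fintype.card_fin]
  rw [show 4 + t - 1 = t + 3 by omega, Nat.choose_symm_add]

lemma cast_choose_three (t : ℕ) :
    (((t + 3).choose 3 : ℕ) : ℚ) = (t + 3) * (t + 2) * (t + 1) / 6 := by
  have h := Nat.ascFactorial_eq_factorial_mul_choose t 3
  have h' : (((t + 1).ascFactorial 3 : ℕ) : ℚ) = ((Nat.factorial 3 * (t + 3).choose 3 : ℕ) : ℚ) :=
    congrArg _ h
  simp [Nat.ascFactorial, Nat.factorial] at h'
  linarith

attribute [local instance] MvPolynomial.gradedAlgebra in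
lemma MvPolynomial.homogeneousComponent_add_mul {σ : Type*} {p : MvPolynomial σ k} {a : ℕ}
    (hp : p.IsHomogeneous a) (u : MvPolynomial σ k) (n : ℕ) :
    homogeneousComponent (n + a) (u * p) = homogeneousComponent n u * p := by
  have := DirectSum.coe_decompose_mul_of_right_mem_of_le (homogeneousSubmodule σ k) (a := u)
    (b := p) (i := a) (n := n + a) hp (Nat.le_add_left _ _)
  rw [Nat.add_sub_cancel] at this
  have key (v : MvPolynomial σ k) (i : ℕ) :
      ((DirectSum.decompose (homogeneousSubmodule σ k) v i : homogeneousSubmodule σ k i) :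
        MvPolynomial σ k) = homogeneousComponent i v := decomposition.decompose'_apply v i
  rwa [key, key] at this

/-- `(u, v) ↦ u p + v q` on pairs of forms of degrees `n` and `m`. -/
noncomputable def pairCombination (p q : MvPolynomial (Fin 4) k) (n m : ℕ) :
    homogeneousSubmodule (Fin 4) k n × homogeneousSubmodule (Fin 4) k m →ₗ[k]
      MvPolynomial (Fin 4) k :=
  ((LinearMap.mulRight k p).comp (homogeneousSubmodule (Fin 4) k n).subtype).coprod
    ((LinearMap.mulRight k q).comp (homogeneousSubmodule (Fin 4) k m).subtype)

lemma pairCombination_apply (p q : MvPolynomial (Fin 4) k) (n m : ℕ)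
    (w : homogeneousSubmodule (Fin 4) k n × homogeneousSubmodule (Fin 4) k m) :
    pairCombination p q n m w = w.1 * p + w.2 * q := by
  simp [pairCombination]

variable {p q : MvPolynomial (Fin 4) k} {a b : ℕ}

/-- The dimension of the part of degree `a + b + s` of the ideal generated by a regular sequence of
two forms of degrees `a` and `b`, read off from the Koszul complex. -/
lemma finrank_range_pairCombination (hp : p.IsHomogeneous a) (hq : q.IsHomogeneous b) (hp0 : p ≠ 0)
    (hpq : ∀ x, p ∣ q * x → p ∣ x) (s : ℕ) :
    Module.finrank k (LinearMap.range (pairCombination p q (b + s) (a + s))) +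
      (s + 3).choose 3 = (b + s + 3).choose 3 + (a + s + 3).choose 3 := by
  have hfin (n : ℕ) : Module.Finite k (homogeneousSubmodule (Fin 4) k n) :=
    Module.Finite.iff_fg.2 (homogeneousSubmodule_fg _ _ n)
  have hrank := LinearMap.finrank_range_add_finrank_ker (pairCombination p q (b + s) (a + s))
  rw [Module.finrank_prod, finrank_homogeneousSubmodule_fin_four,
    finrank_homogeneousSubmodule_fin_four] at hrank
  rw [← hrank, ← finrank_homogeneousSubmodule_fin_four (k := k)]
  congr 1
  -- the kernel consists of the multiples of `(q, -p)`
  have h1 (γ : homogeneousSubmodule (Fin 4) k s) :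
      (γ : MvPolynomial (Fin 4) k) * q ∈ homogeneousSubmodule (Fin 4) k (b + s) := by
    rw [add_comm b]
    exact IsHomogeneous.mul γ.2 hq
  have h2 (γ : homogeneousSubmodule (Fin 4) k s) :
      -((γ : MvPolynomial (Fin 4) k) * p) ∈ homogeneousSubmodule (Fin 4) k (a + s) := by
    rw [add_comm a]
    exact (IsHomogeneous.mul γ.2 hp).neg
  let Ψ : homogeneousSubmodule (Fin 4) k s →ₗ[k]
      LinearMap.ker (pairCombination p q (b + s) (a + s)) :=
    { toFun := fun γ => ⟨(⟨_, h1 γ⟩, ⟨_, h2 γ⟩), by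
        rw [LinearMap.mem_ker, pairCombination_apply]
        ring⟩
      map_add' := fun x y => Subtype.ext (Prod.ext (Subtype.ext (add_mul _ _ _))
        (Subtype.ext ((congrArg _ (add_mul _ _ _)).trans (neg_add _ _))))
      map_smul' := fun c x => Subtype.ext (Prod.ext (Subtype.ext (smul_mul_assoc _ _ _))
        (Subtype.ext ((congrArg _ (smul_mul_assoc _ _ _)).trans (smul_neg _ _).symm))) }
  refine LinearEquiv.finrank_eq (LinearEquiv.ofBijective Ψ ⟨fun x y hxy => ?_, fun w => ?_⟩)
  · have := congrArg (fun w => ((w.1.2 : homogeneousSubmodule (Fin 4) k (a + s)) :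
      MvPolynomial (Fin 4) k)) hxy
    exact Subtype.ext (mul_right_cancel₀ hp0 (neg_injective this))
  · obtain ⟨⟨u, v⟩, hw⟩ := w
    rw [LinearMap.mem_ker, pairCombination_apply] at hw
    obtain ⟨e, he⟩ := hpq v ⟨-u, by linear_combination hw⟩
    have hu : (u : MvPolynomial (Fin 4) k) = -e * q := by
      apply mul_right_cancel₀ hp0
      simp only at hw
      rw [he] at hw
      linear_combination hw
    have hv : -((homogeneousComponent s (-e)) * p) = (v : MvPolynomial (Fin 4) k) := by
      rw [← homogeneousComponent_add_mul hp, neg_mul, map_neg, neg_neg, mul_comm e, ← he,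
        add_comm s]
      exact homogeneousComponent_eq_self v.2
    have hu' : homogeneousComponent s (-e) * q = (u : MvPolynomial (Fin 4) k) := by
      rw [← homogeneousComponent_add_mul hq, ← hu, add_comm s]
      exact homogeneousComponent_eq_self u.2
    refine ⟨⟨homogeneousComponent s (-e), homogeneousComponent_isHomogeneous s _⟩, ?_⟩
    exact Subtype.ext (Prod.ext (Subtype.ext hu') (Subtype.ext hv))

lemma hilbertFn_span_pair (hp : p.IsHomogeneous a) (hq : q.IsHomogeneous b) (hp0 : p ≠ 0)
    (hpq : ∀ x, p ∣ q * x → p ∣ x) (s : ℕ) :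
    hilbertFn (Ideal.span {p, q}) (a + b + s) + (b + s + 3).choose 3 + (a + s + 3).choose 3 =
      (a + b + s + 3).choose 3 + (s + 3).choose 3 := by
  have hfin (n : ℕ) : Module.Finite k (homogeneousSubmodule (Fin 4) k n) :=
    Module.Finite.iff_fg.2 (homogeneousSubmodule_fg _ _ n)
  set t := a + b + s with ht
  set π := (Ideal.Quotient.mkₐ k (Ideal.span {p, q})).toLinearMap with hπ
  have hrank := LinearMap.finrank_range_add_finrank_ker
    (π.domRestrict (homogeneousSubmodule (Fin 4) k t))
  rw [LinearMap.range_domRestrict, finrank_homogeneousSubmodule_fin_four] at hrank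
  have hker : (LinearMap.ker (π.domRestrict (homogeneousSubmodule (Fin 4) k t))).map
      (homogeneousSubmodule (Fin 4) k t).subtype =
        LinearMap.range (pairCombination p q (b + s) (a + s)) := by
    ext x
    have hxI : π x = 0 ↔ x ∈ Ideal.span {p, q} := Ideal.Quotient.eq_zero_iff_mem
    constructor
    · rintro ⟨y, hy, rfl⟩
      have hy' : (y : MvPolynomial (Fin 4) k) ∈ Ideal.span {p, q} :=
        Ideal.Quotient.eq_zero_iff_mem.1 hy
      obtain ⟨u, v, huv⟩ := Ideal.mem_span_pair.1 hy'
      refine ⟨(⟨homogeneousComponent (b + s) u, homogeneousComponent_isHomogeneous _ _⟩,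
        ⟨homogeneousComponent (a + s) v, homogeneousComponent_isHomogeneous _ _⟩), ?_⟩
      rw [pairCombination_apply]
      have := homogeneousComponent_eq_self y.2
      rw [← huv, map_add] at this
      rw [Submodule.subtype_apply, ← huv]
      conv_rhs => rw [← this]
      rw [show t = (b + s) + a by omega, homogeneousComponent_add_mul hp,
        show (b + s) + a = (a + s) + b by omega, homogeneousComponent_add_mul hq]
    · rintro ⟨⟨u, v⟩, rfl⟩
      rw [pairCombination_apply]
      have hmem : (u : MvPolynomial (Fin 4) k) * p + v * q ∈ homogeneousSubmodule (Fin 4) k t := by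
        refine add_mem ?_ ?_
        · rw [show t = (b + s) + a by omega]
          exact IsHomogeneous.mul u.2 hp
        · rw [show t = (a + s) + b by omega]
          exact IsHomogeneous.mul v.2 hq
      exact ⟨⟨_, hmem⟩, Ideal.Quotient.eq_zero_iff_mem.2 (Ideal.mem_span_pair.2 ⟨u, v, rfl⟩), rfl⟩
  have hker' : Module.finrank k (LinearMap.ker (π.domRestrict (homogeneousSubmodule (Fin 4) k t))) =
      Module.finrank k (LinearMap.range (pairCombination p q (b + s) (a + s))) := by
    rw [← hker]
    exact (Submodule.equivMapOfInjective _ (Submodule.injective_subtype _) _).finrank_eq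
  rw [hker'] at hrank
  have := finrank_range_pairCombination hp hq hp0 hpq s
  have hH : hilbertFn (Ideal.span {p, q}) t =
    Module.finrank k ((homogeneousSubmodule (Fin 4) k t).map π) := rfl
  omega

/-- A complete intersection of two forms of degrees `a` and `b` has degree `a * b`. -/
theorem hasDegree_span_pair (hp : p.IsHomogeneous a) (hq : q.IsHomogeneous b) (hp0 : p ≠ 0)
    (hpq : ∀ x, p ∣ q * x → p ∣ x) (ha : 0 < a) (hb : 0 < b) :
    HasDegree (Ideal.span {p, q}) (a * b) := by
  have hab : (a * b : ℚ) ≠ 0 := by positivity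
  -- the alternating sum of the four binomial coefficients is linear in `t`, with slope `a * b`
  refine ⟨Polynomial.C (a * b : ℚ) * Polynomial.X +
    Polynomial.C ((a * b : ℚ) * (2 - (a + b) / 2)), ?_, ?_⟩
  · filter_upwards [Filter.eventually_ge_atTop (a + b)] with t ht
    obtain ⟨s, rfl⟩ := Nat.exists_eq_add_of_le ht
    have h := congrArg (Nat.cast (R := ℚ)) (hilbertFn_span_pair hp hq hp0 hpq s)
    simp only [Nat.cast_add, cast_choose_three] at h
    simp
    linear_combination h
  · rw [Polynomial.natDegree_linear hab, Polynomial.leadingCoeff_linear hab]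
    simp

end HilbertFunction

/-! ### The structure theorem -/

section Main

variable {k : Type*} [Field k]

open scoped Pointwise in
lemma isRegular_pair {p q : MvPolynomial (Fin 4) k} {a b : ℕ} (hp : p.IsHomogeneous a)
    (hq : q.IsHomogeneous b) (ha : 0 < a) (hb : 0 < b) (hp0 : p ≠ 0)
    (hpq : ∀ x, p ∣ q * x → p ∣ x) :
    RingTheory.Sequence.IsRegular (MvPolynomial (Fin 4) k) [p, q] := by
  refine ⟨?_, ?_⟩
  · rw [RingTheory.Sequence.isWeaklyRegular_cons_iff,
      RingTheory.Sequence.isWeaklyRegular_singleton_iff]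
    refine ⟨fun x y hxy => mul_left_cancel₀ hp0 hxy, ?_⟩
    have hmem (x : MvPolynomial (Fin 4) k) :
        x ∈ p • (⊤ : Submodule (MvPolynomial (Fin 4) k) (MvPolynomial (Fin 4) k)) ↔ p ∣ x := by
      rw [Submodule.mem_smul_pointwise_iff_exists]
      exact ⟨fun ⟨y, _, hy⟩ => ⟨y, hy.symm⟩, fun ⟨y, hy⟩ => ⟨y, trivial, hy.symm⟩⟩
    rw [isSMulRegular_quotient_iff_mem_of_smul_mem]
    intro x hx
    rw [hmem] at hx ⊢
    exact hpq x hx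
  · -- both forms vanish at the origin
    intro htop
    have h1 : (1 : MvPolynomial (Fin 4) k) ∈ Ideal.ofList [p, q] • (⊤ : Ideal _) := by
      rw [← htop]; trivial
    have hcoeff {r : MvPolynomial (Fin 4) k} {n : ℕ} (hr : r.IsHomogeneous n) (hn : 0 < n) :
        constantCoeff r = 0 := hr.coeff_eq_zero (by simpa using hn.ne)
    have hle : Ideal.ofList [p, q] • (⊤ : Ideal (MvPolynomial (Fin 4) k)) ≤
        RingHom.ker (constantCoeff (σ := Fin 4) (R := k)) := by
      rw [smul_eq_mul, Ideal.mul_top, Ideal.ofList, Ideal.span_le]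
      intro x hx
      simp only [List.mem_cons, List.not_mem_nil, or_false, Set.mem_ofPred_eq] at hx
      rcases hx with rfl | rfl
      · exact hcoeff hp ha
      · exact hcoeff hq hb
    simpa [RingHom.mem_ker] using hle h1

lemma span_range_mul_col_le {ι κ κ' R : Type*} [CommRing R] [Fintype κ] (M : Matrix ι κ R)
    (N : Matrix κ κ' R) (j : κ') :
    Ideal.span (Set.range fun i => (M * N) i j) ≤ Ideal.span (Set.range fun i => N i j) := by
  rw [Ideal.span_le]
  rintro _ ⟨i, rfl⟩
  simp only [Matrix.mul_apply]
  exact Ideal.sum_mem _ fun m _ => Ideal.mul_mem_left _ _ (Ideal.subset_span ⟨m, rfl⟩)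

lemma koszulBlock_map (τ : MvPolynomial (Fin 4) k ≃ₐ[k] MvPolynomial (Fin 4) k)
    (l₀ l₁ l₂ q₀ q₁ q₂ q : MvPolynomial (Fin 4) k) :
    (koszulBlock l₀ l₁ l₂ q₀ q₁ q₂ q).map τ =
      koszulBlock (τ l₀) (τ l₁) (τ l₂) (τ q₀) (τ q₁) (τ q₂) (τ q) := by
  ext i j : 1
  fin_cases i <;> fin_cases j <;> simp [koszulBlock]

lemma range_vec_four {R : Type*} (a b c e : R) : Set.range ![a, b, c, e] = {a, b, c, e} := by
  simp only [Matrix.range_cons, Matrix.range_empty, Set.union_empty, Set.singleton_union]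

lemma span_range_eq_of_last_eq_zero {R : Type*} [CommRing R] {M : Matrix (Fin 4) (Fin 1) R}
    (h : M 3 0 = 0) :
    Ideal.span (Set.range fun i => M i 0) = Ideal.span {M 0 0, M 1 0, M 2 0} := by
  refine le_antisymm (Ideal.span_le.2 ?_) (Ideal.span_mono ?_)
  · rintro _ ⟨i, rfl⟩
    match i with
    | 0 => exact Ideal.subset_span (by simp)
    | 1 => exact Ideal.subset_span (by simp)
    | 2 => exact Ideal.subset_span (by simp)
    | 3 => exact (congrArg (· ∈ _) h).mpr (zero_mem (Ideal.span _))
  · rintro _ (rfl | rfl | rfl)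
    exacts [⟨0, rfl⟩, ⟨1, rfl⟩, ⟨2, rfl⟩]

end Main

theorem mainTheorem4 {k : Type*} [Field k] (d : ℕ)
    (J : Ideal (MvPolynomial (Fin 4) k))
    (f : Fin 4 → MvPolynomial (Fin 4) k)
    (φ : Matrix (Fin 4) (Fin 4) (MvPolynomial (Fin 4) k))
    (ψ : Matrix (Fin 4) (Fin 1) (MvPolynomial (Fin 4) k))
    (hcodim : J.height = 2)
    (hres : IsMinimalGradedResolution J
      (fun _ => (d : ℤ))
      ![(d : ℤ) + 1, (d : ℤ) + 1, (d : ℤ) + 1, 2 * (d : ℤ) - 1]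
      (fun _ => (d : ℤ) + 2) f φ ψ)
    (hunm : d = 2 → ¬ IsUnmixed J) :
    {P : Ideal (MvPolynomial (Fin 4) k) |
        P ∈ associatedPrimes (MvPolynomial (Fin 4) k) (MvPolynomial (Fin 4) k ⧸ J) ∧
        P.height = 3} = {Ideal.span (Set.range fun i => ψ i 0)} ∧
    (∃ (τ : MvPolynomial (Fin 4) k ≃ₐ[k] MvPolynomial (Fin 4) k)
        (A B : Matrix.GeneralLinearGroup (Fin 4) k)
        (q₀ q₁ q₂ q : MvPolynomial (Fin 4) k),
      IsLinearChange τ ∧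
      (3 ≤ d → B = 1) ∧
      q₀.IsHomogeneous (d - 1) ∧ q₁.IsHomogeneous (d - 1) ∧ q₂.IsHomogeneous (d - 1) ∧
      q.IsHomogeneous (d - 1) ∧
      scalarMatrix B * ψ.map τ = !![X 0; X 1; X 2; 0] ∧
      scalarMatrix A * φ.map τ = koszulNormalForm q₀ q₁ q₂ q * scalarMatrix B ∧
      (fun j => τ (f j)) =
        Matrix.vecMul ![q * X 0, q * X 1, q * X 2, q₀ * X 0 + q₁ * X 1 + q₂ * X 2]
          (scalarMatrix A) ∧
      J.map τ =
        Ideal.span {q * X 0, q * X 1, q * X 2, q₀ * X 0 + q₁ * X 1 + q₂ * X 2} ∧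
      (unmixedPart J).map τ = Ideal.span {q, q₀ * X 0 + q₁ * X 1 + q₂ * X 2} ∧
      RingTheory.Sequence.IsRegular (MvPolynomial (Fin 4) k)
        [q, q₀ * X 0 + q₁ * X 1 + q₂ * X 2]) ∧
    HasDegree (unmixedPart J) ((d - 1) * d) := by
  have hd : 2 ≤ d := IsFourGeneratorResolution.two_le hres
  have hR := primesHaveGradeThree k 4
  obtain ⟨B, hB, h, h3⟩ := IsFourGeneratorResolution.exists_last_entry_eq_zero hres hcodim hunm
  set φ' := φ * scalarMatrix B⁻¹ with hφ'
  set ψ' := scalarMatrix B * ψ with hψ'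
  obtain ⟨τ, hτ, -, hτψ⟩ := exists_isLinearChange_three h.isHomogeneous_ψ_castSucc
    (h.linearIndependent_ψ h3)
  have hτ0 : τ (ψ' 0 0) = X 0 := hτψ 0
  have hτ1 : τ (ψ' 1 0) = X 1 := hτψ 1
  have hτ2 : τ (ψ' 2 0) = X 2 := hτψ 2
  obtain ⟨A, q₀, q₁, q₂, q, hq₀, hq₁, hq₂, hq, hq0, hqh, hA, hf⟩ :=
    h.exists_normalForm hd hcodim h3 hτ hτψ
  set g := q₀ * ψ' 0 0 + q₁ * ψ' 1 0 + q₂ * ψ' 2 0 with hg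
  have hτg : τ g = τ q₀ * X 0 + τ q₁ * X 1 + τ q₂ * X 2 := by
    simp only [hg, map_add, map_mul, hτ0, hτ1, hτ2]
  have hghom : g.IsHomogeneous d := by
    have hmul {r : MvPolynomial (Fin 4) k} (hr : r.IsHomogeneous (d - 1)) (j : Fin 3) :
        (r * ψ' j.castSucc 0).IsHomogeneous d := by
      have := hr.mul (h.isHomogeneous_ψ_castSucc j)
      rwa [Nat.sub_add_cancel (by omega)] at this
    exact ((hmul hq₀ 0).add (hmul hq₁ 1)).add (hmul hq₂ 2)
  have hJ : J = Ideal.span {q * ψ' 0 0, q * ψ' 1 0, q * ψ' 2 0, g} := by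
    rw [← hres.span_f, hf, span_range_vecMul_scalarMatrix, range_vec_four]
  -- the ideal of the entries of `ψ` is a prime of height three, since `τ` maps it to
  -- `(X 0, X 1, X 2)`
  have hLmap : Ideal.map τ.toRingEquiv (Ideal.span {ψ' 0 0, ψ' 1 0, ψ' 2 0}) =
      Ideal.span {X 0, X 1, X 2} := by
    rw [Ideal.map_span, Set.image_insert_eq, Set.image_pair]
    exact congrArg Ideal.span (by rw [← hτ0, ← hτ1, ← hτ2]; rfl)
  have hLheight : (Ideal.span {ψ' 0 0, ψ' 1 0, ψ' 2 0}).height = 3 := by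
    rw [← τ.toRingEquiv.height_map, hLmap]
    exact height_span_X_three (by decide) (by decide) (by decide)
  have hLprime : (Ideal.span {ψ' 0 0, ψ' 1 0, ψ' 2 0}).IsPrime := by
    have hX := isPrime_span_X_image (k := k) ({0, 1, 2} : Set (Fin 4))
    rw [Set.image_insert_eq, Set.image_pair, ← hLmap] at hX
    have := Ideal.comap_map_of_bijective τ.toRingEquiv τ.toRingEquiv.bijective
      (I := Ideal.span {ψ' 0 0, ψ' 1 0, ψ' 2 0})
    rw [← this]
    exact Ideal.IsPrime.comap _
  have hψspan : Ideal.span (Set.range fun i => ψ i 0) =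
      Ideal.span {ψ' 0 0, ψ' 1 0, ψ' 2 0} := by
    rw [← span_range_eq_of_last_eq_zero h3]
    refine le_antisymm ?_ (span_range_mul_col_le _ _ _)
    have : ψ = scalarMatrix B⁻¹ * ψ' := by
      rw [hψ', ← Matrix.mul_assoc, scalarMatrix_inv_mul, Matrix.one_mul]
    rw [show (fun i => ψ i 0) = fun i => (scalarMatrix B⁻¹ * ψ') i 0 from
      funext fun i => congrFun (congrFun this i) 0]
    exact span_range_mul_col_le _ _ _
  have hgL : g ∈ Ideal.span {ψ' 0 0, ψ' 1 0, ψ' 2 0} := by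
    have h0 : ψ' 0 0 ∈ Ideal.span {ψ' 0 0, ψ' 1 0, ψ' 2 0} := Ideal.subset_span (by simp)
    have h1 : ψ' 1 0 ∈ Ideal.span {ψ' 0 0, ψ' 1 0, ψ' 2 0} := Ideal.subset_span (by simp)
    have h2 : ψ' 2 0 ∈ Ideal.span {ψ' 0 0, ψ' 1 0, ψ' 2 0} := Ideal.subset_span (by simp)
    exact add_mem (add_mem (Ideal.mul_mem_left _ _ h0) (Ideal.mul_mem_left _ _ h1))
      (Ideal.mul_mem_left _ _ h2)
  have hunmixed : unmixedPart J = Ideal.span {q, g} := by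
    rw [hJ]
    exact unmixedPart_eq_span_pair hR hLheight hq0 hqh (hJ ▸ hcodim)
  refine ⟨?_, ⟨τ, A, B, τ q₀, τ q₁, τ q₂, τ q, hτ, hB, hτ.isHomogeneous hq₀,
    hτ.isHomogeneous hq₁, hτ.isHomogeneous hq₂, hτ.isHomogeneous hq, ?_, ?_, ?_, ?_, ?_, ?_⟩, ?_⟩
  · rw [hψspan, hJ]
    exact associatedPrimes_height_three_eq hR hLprime hLheight hq0 hqh hgL
  · rw [← scalarMatrix_map B τ, ← Matrix.map_mul]
    ext i j : 1
    rw [Subsingleton.elim j 0, Matrix.map_apply, ← hψ']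
    match i with
    | 0 => exact hτ0
    | 1 => exact hτ1
    | 2 => exact hτ2
    | 3 => rw [h3, map_zero]; rfl
  · have hφ : φ = φ' * scalarMatrix B := by
      rw [hφ', Matrix.mul_assoc, scalarMatrix_inv_mul, Matrix.mul_one]
    have := congrArg (fun M => M.map τ) hA
    simp only [Matrix.map_mul, scalarMatrix_map, koszulBlock_map, hτ0, hτ1, hτ2] at this
    rw [hφ, Matrix.map_mul, scalarMatrix_map, ← Matrix.mul_assoc, this]
    rfl
  · have hvec : (fun j => τ (f j)) = Matrix.vecMul
        (τ ∘ ![q * ψ' 0 0, q * ψ' 1 0, q * ψ' 2 0, g]) ((scalarMatrix A).map τ) := by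
      funext j
      conv_lhs => rw [hf]
      exact RingHom.map_vecMul (τ : MvPolynomial (Fin 4) k →+* MvPolynomial (Fin 4) k) _ _ _
    rw [hvec, scalarMatrix_map, ← hτg]
    congr 1
    funext j
    match j with
    | 0 => simp [hτ0]
    | 1 => simp [hτ1]
    | 2 => simp [hτ2]
    | 3 => rfl
  · conv_lhs => rw [hJ]
    rw [Ideal.map_span]
    simp only [Set.image_insert_eq, Set.image_singleton, map_mul, hτ0, hτ1, hτ2, hτg]
  · rw [hunmixed, Ideal.map_span, Set.image_pair, hτg]
  · rw [← hτg]
    refine isRegular_pair (hτ.isHomogeneous hq) (hτ.isHomogeneous hghom) (by omega) (by omega)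
      (by simpa using hq0) fun x hx => ?_
    obtain ⟨y, rfl⟩ := τ.surjective x
    rw [← map_mul, map_dvd_iff] at hx
    exact map_dvd τ (hqh y hx)
  · rw [hunmixed]
    exact hasDegree_span_pair hq hghom hq0 hqh (by omega) (by omega)
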